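/- **Setting.** Let $N\ge 1$ and $e_{\max}\ge 0$ be integers. An energy harvesting device transmits over $N$ sub-carriers. In each slot the channel state is $s=(g,h)$ with gain vectors $g,h\in\mathbb R_{\ge0}^N$ (legitimate receiver, eavesdropper); it is drawn i.i.d. over time from a finite set $\mathcal S$, each element of which has positive probability. The number $B$ of energy quanta harvested in a slot is i.i.d. over time, independent of the channel, with values in $\{0,1,2,\dots\}$ and $\mathbb P(B>0)>0$. For a power vector $\rho\in\mathbb R_{\ge 0}^N$ the secrecy rate is $c(\rho,g,h)=\sum_{r=1}^N R_{g_r,h_r}(\rho_r)$, where either (variable rate coding) $R_{g,h}(p)=\log(1+gp)-\log(1+\min\{g,h\}p)$, or (constant rate coding) $R_{g,h}(p)=\log(1+gp)-\log(1+hp)$; the statement holds for each of the two. For $x\ge0$ let $c^\star(x;s)=\max\{c(\rho,g,h):\rho\ge0,\ \sum_r\rho_r=x\}$ be the optimally split secrecy rate at total power $x$, and for $s',s''\in\mathcal S$ put $$D(x;s';s'')=\frac{\partial}{\partial x}\bigl(c^\star(x;s'')-c^\star(x;s')\bigr).$$ Conditions on the sign of $D$ are understood at those $x$ where this derivative exists.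 The battery level lies in $\{0,\dots,e_{\max}\}$. At level $e$ a power vector $\rho\ge0$ is feasible if its total $\sum_r\rho_r$ is one of $0,1,\dots,e$; the level then becomes $\min\{e-\sum_r\rho_r+B,\ e_{\max}\}$. A policy assigns to each pair $(e,s)$ a discrete probability distribution on the vectors feasible at $e$. Its long-term secrecy rate from the initial level $e_0$ is $\liminf_{K\to\infty}\frac1{K+1}\sum_{k=0}^{K}\mathbb E[c(\rho^{(k)},g^{(k)},h^{(k)})]$. A policy is *optimal* if it maximizes this quantity among all policies for every initial level, and *unichain* if the Markov chain of battery levels has a single recurrent class. An *optimal secrecy policy* (OSP) is a deterministic, unichain, optimal policy that uses zero power at every transient battery level. For a deterministic policy let $\rho^{\rm tot}_{e,s}$ be its total power in state $(e,s)$. **Proposition.** 1. There is an OSP such that for all $e\in\{0,\dots,e_{\max}\}$ and all $s',s''\in\mathcal S$: (a) if $D(x;s';s'')\ge0$ for all $x\in(0,e_{\max})$, then $\rho^{\rm tot}_{e,s''}\ge\rho^{\rm tot}_{e,s'}$; (b) if $D(x;s';s'')\le0$ for all $x\in(0,e_{\max})$, then $\rho^{\rm tot}_{e,s''}\le\rho^{\rm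 tot}_{e,s'}$. In particular, if the total powers of the OSP are uniquely determined, then the OSP satisfies (a) and (b). 2. Every OSP satisfies (a) and (b) for all $e,s',s''$, except possibly for ties: whenever the conclusion of (a) or of (b) fails although its hypothesis holds, $D(x;s';s'')=0$ for all $x$ strictly between $\rho^{\rm tot}_{e,s'}$ and $\rho^{\rm tot}_{e,s''}$, and the policy can be changed in the single state $(e,s')$ so that its total power there becomes $\rho^{\rm tot}_{e,s''}$, and likewise in the single state $(e,s'')$ so that its total power there becomes $\rho^{\rm tot}_{e,s'}$, in both cases remaining deterministic, unichain and optimal. -/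

import Mathlib

noncomputable section

namespace Secrecy

/-- The two coding strategies of the transmitter. -/
inductive Coding where
  | varRate
  | conRate

/-- A channel state: the gains `g` of the legitimate receiver (first component) and the gains `h`
of the eavesdropper (second component) on the `N` sub-carriers. -/
abbrev ChannelState (N : ℕ) := (Fin N → ℝ) × (Fin N → ℝ)

/-- Secrecy rate of one sub-carrier with gains `g`, `h` at transmission power `p`. -/
def subRate (κ : Coding) (g h p : ℝ) : ℝ :=
  match κ with
  | .varRate => Real.log (1 + g * p) - Real.log (1 + min g h * p)
  | .conRate => Real.log (1 + g * p) - Real.log (1 + h * p)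

/-- Instantaneous secrecy rate `c(ρ, g, h)` of the power allocation vector `ρ`. -/
def rate {N : ℕ} (κ : Coding) (ρ : Fin N → ℝ) (s : ChannelState N) : ℝ :=
  ∑ r, subRate κ (s.1 r) (s.2 r) (ρ r)

/-- The power allocation vectors of total power exactly `x`. -/
def splits (N : ℕ) (x : ℝ) : Set (Fin N → ℝ) :=
  {ρ | (∀ r, 0 ≤ ρ r) ∧ ∑ r, ρ r = x}

/-- The optimally split secrecy rate `c(ρ⋆, g, h)`, where `ρ⋆` maximizes `c(·, g, h)` among the
vectors of total power `x` (a maximizer exists, see `exists_optimal_split`). -/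
def optRate {N : ℕ} (κ : Coding) (s : ChannelState N) (x : ℝ) : ℝ :=
  sSup ((fun ρ => rate κ ρ s) '' splits N x)

/-- `D(x; g', h'; g'', h'')`: derivative in the total power `x` of the difference between the
optimally split secrecy rates in the states `s'' = (g'', h'')` and `s' = (g', h')`.
(Where the difference has no derivative, this is `0`.) -/
def D {N : ℕ} (κ : Coding) (s' s'' : ChannelState N) (x : ℝ) : ℝ :=
  deriv (fun y => optRate κ s'' y - optRate κ s' y) x

theorem exists_optimal_split {N : ℕ} (hN : 0 < N) (κ : Coding) (s : ChannelState N)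
    (hs : ∀ r, 0 ≤ s.1 r ∧ 0 ≤ s.2 r) {x : ℝ} (hx : 0 ≤ x) :
    ∃ ρ ∈ splits N x, IsMaxOn (fun ρ => rate κ ρ s) (splits N x) ρ ∧
      optRate κ s x = rate κ ρ s := by
  have hne : (splits N x).Nonempty := by
    refine ⟨Pi.single ⟨0, hN⟩ x, fun r => ?_, ?_⟩
    · by_cases h : r = ⟨0, hN⟩
      · subst h; simpa using hx
      · simp [h]
    · simp
  have hcpt : IsCompact (splits N x) := by
    refine (isCompact_univ_pi (fun _ : Fin N => isCompact_Icc (a := (0 : ℝ)) (b := x))).of_isClosed_subset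
      ?_ ?_
    · refine IsClosed.inter (s₁ := {ρ : Fin N → ℝ | ∀ r, 0 ≤ ρ r})
        (s₂ := {ρ : Fin N → ℝ | ∑ r, ρ r = x}) ?_ ?_
      · simp only [Set.ofPred_forall]
        exact isClosed_iInter fun r => isClosed_le continuous_const (continuous_apply r)
      · exact isClosed_eq (by fun_prop) continuous_const
    · rintro ρ ⟨h0, h1⟩ r -
      exact ⟨h0 r, h1 ▸ Finset.single_le_sum (fun i _ => h0 i) (Finset.mem_univ r)⟩
  have key : ∀ a : ℝ, 0 ≤ a → ∀ r : Fin N,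
      ContinuousOn (fun ρ : Fin N → ℝ => Real.log (1 + a * ρ r)) (splits N x) := by
    intro a ha r
    refine ContinuousOn.log (by fun_prop) fun ρ hρ => ?_
    have := mul_nonneg ha (hρ.1 r)
    positivity
  have hcont : ContinuousOn (fun ρ => rate κ ρ s) (splits N x) := by
    unfold rate
    refine continuousOn_finsetSum _ fun r _ => ?_
    cases κ
    · exact (key _ (hs r).1 r).sub (key _ (le_min (hs r).1 (hs r).2) r)
    · exact (key _ (hs r).1 r).sub (key _ (hs r).2 r)
  obtain ⟨ρ, hρ, hmax⟩ := hcpt.exists_isMaxOn hne hcont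
  refine ⟨ρ, hρ, hmax, ?_⟩
  refine IsGreatest.csSup_eq ⟨⟨ρ, hρ, rfl⟩, ?_⟩
  rintro _ ⟨τ, hτ, rfl⟩
  exact hmax hτ

/-- The energy harvesting device with `N` sub-carriers: battery size, finite set of channel states
(nonnegative gains), law of the channel state in a slot (i.i.d. over time, every state of the set
having positive probability), and law of the number of energy quanta harvested in a slot (i.i.d.
over time, independent of the channel). -/
structure Model (N : ℕ) where
  emax : ℕ
  channels : Finset (ChannelState N)
  gain_nonneg : ∀ s ∈ channels, ∀ r, 0 ≤ s.1 r ∧ 0 ≤ s.2 r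
  channelLaw : PMF channels
  channelLaw_pos : ∀ s, channelLaw s ≠ 0
  arrivalLaw : PMF ℕ

/-- A power allocation feasible with `e` energy quanta: a nonnegative power vector whose total is
one of the numbers `0, …, e` of energy quanta. -/
structure Alloc (N e : ℕ) where
  power : Fin N → ℝ
  total : ℕ
  nonneg : ∀ r, 0 ≤ power r
  sum_power : ∑ r, power r = total
  total_le : total ≤ e

variable {N : ℕ}

/-- The energy levels `0, …, emax`. -/
abbrev Model.Energy (M : Model N) := Fin (M.emax + 1)

/-- A (randomized) power allocation policy: for each energy level and channel state, a pmf on the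
feasible power allocations. -/
abbrev Model.Policy (M : Model N) := (e : M.Energy) → M.channels → PMF (Alloc N e)

/-- A deterministic policy. -/
abbrev Model.DetPolicy (M : Model N) := (e : M.Energy) → M.channels → Alloc N e

/-- A deterministic policy as a policy. -/
def Model.DetPolicy.toPolicy {M : Model N} (μ : M.DetPolicy) : M.Policy :=
  fun e s => PMF.pure (μ e s)

/-- Battery update `min {e - x + b, emax}` (where `x ≤ e` is the total power used). -/
def Model.update (M : Model N) (e : M.Energy) (x b : ℕ) : M.Energy :=
  ⟨min (e - x + b) M.emax, Nat.lt_succ_of_le (min_le_right _ _)⟩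

/-- Law of the next energy level, given the present one. -/
def Model.step (M : Model N) (μ : M.Policy) (e : M.Energy) : PMF M.Energy :=
  M.channelLaw.bind fun s => (μ e s).bind fun ρ => M.arrivalLaw.map fun b => M.update e ρ.total b

/-- Law of the energy level in slot `k`, given the energy level `e₀` in slot `0`. -/
def Model.energyLaw (M : Model N) (μ : M.Policy) (e₀ : M.Energy) : ℕ → PMF M.Energy
  | 0 => PMF.pure e₀
  | k + 1 => (M.energyLaw μ e₀ k).bind (M.step μ)

/-- Expected secrecy rate of a slot that starts with `e` energy quanta. -/
def Model.slotRate (M : Model N) (κ : Coding) (μ : M.Policy) (e : M.Energy) : ℝ :=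
  ∑ s : M.channels, (M.channelLaw s).toReal *
    ∑' ρ : Alloc N e, (μ e s ρ).toReal * rate κ ρ.power s

/-- Long-term average secrecy rate `C_μ(e₀)`: the lower limit, as `K → ∞`, of the expected secrecy
rate averaged over the slots `0, …, K`. -/
def Model.avgRate (M : Model N) (κ : Coding) (μ : M.Policy) (e₀ : M.Energy) : ℝ :=
  Filter.liminf (fun K : ℕ => (∑ k ∈ Finset.range (K + 1),
    ∑ e, (M.energyLaw μ e₀ k e).toReal * M.slotRate κ μ e) / ((K : ℝ) + 1)) Filter.atTop

/-- The policy `μ` maximizes the long-term secrecy rate among all policies, for every initial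
energy level. -/
def Model.IsOptimal (M : Model N) (κ : Coding) (μ : M.Policy) : Prop :=
  ∀ (ν : M.Policy) (e₀ : M.Energy), M.avgRate κ ν e₀ ≤ M.avgRate κ μ e₀

/-- The energy level `e'` can be reached from `e` with positive probability. -/
def Model.Reach (M : Model N) (μ : M.Policy) : M.Energy → M.Energy → Prop :=
  Relation.ReflTransGen fun a b => M.step μ a b ≠ 0

/-- Recurrent energy levels; the others are transient. -/
def Model.IsRecurrent (M : Model N) (μ : M.Policy) (e : M.Energy) : Prop :=
  ∀ e', M.Reach μ e e' → M.Reach μ e' e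

/-- The energy levels have a single recurrent class. -/
def Model.IsUnichain (M : Model N) (μ : M.Policy) : Prop :=
  ∀ e e', M.IsRecurrent μ e → M.IsRecurrent μ e' → M.Reach μ e e'

/-- Optimal secrecy policy: deterministic, unichain, maximizing the long-term secrecy rate, and
transmitting nothing in the transient energy levels. -/
structure Model.IsOSP (M : Model N) (κ : Coding) (μ : M.DetPolicy) : Prop where
  optimal : M.IsOptimal κ μ.toPolicy
  unichain : M.IsUnichain μ.toPolicy
  transient : ∀ e, ¬ M.IsRecurrent μ.toPolicy e → ∀ s, (μ e s).total = 0

/-- Changing `μ` in the single state `(e, s)`, so that the total power there becomes `x`, can be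
done so that the policy stays unichain and optimal. -/
def Model.CanReplace (M : Model N) (κ : Coding) (μ : M.DetPolicy) (e : M.Energy) (s : M.channels)
    (x : ℕ) : Prop :=
  ∃ ν : M.DetPolicy, M.IsOptimal κ ν.toPolicy ∧ M.IsUnichain ν.toPolicy ∧ (ν e s).total = x ∧
    ∀ (a : M.Energy) (t : M.channels), (a, t) ≠ (e, s) → ν a t = μ a t

end Secrecy

end

/-! The problem is an average-reward Markov decision process. A solution `(g, h)` of its optimality
equation (`exists_average_optimality_equation`) bounds every long-term rate by `g`, and an optimal
policy loses nothing at its recurrent levels: its splits are optimal and its totals maximize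
`actionValue`, that is `reward κ s x + nextMean h e x` (`slotRate_add_eq_of_recurrent`,
`slotRate_add_eq_bellman_iff`).

Channel states are i.i.d. and independent of the arrivals, so the future term `nextMean h e x` does
not involve `s`. The rest is monotone comparative statics. The optimal rates are Lipschitz in the
total power, so the sign of `D` makes their difference monotone; adding the two maximality
inequalities then shows that maximizers in the wrong order maximize both action values (`exchange`).
Largest maximizers are therefore ordered, and any other violation is a tie.

Taking largest maximizers need not give a unichain policy, nor zero power at transient levels.
`exists_isOSP` repairs this: one recurrent class of that policy is shifted upwards until its top is
the full battery, and no power is used outside the shifted class, so the battery fills up and enters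
it. The shift keeps the dynamics and the rewards, and at each level one shift serves all channel
states, so the ordering survives. For an arbitrary optimal secrecy policy, transient levels are
trivial and ties at recurrent levels are handled by `canReplace`. -/

noncomputable section

namespace Secrecy

open Filter Topology

/-! ### Finite Markov chains: occupation averages and stationary distributions. -/

section MarkovChain

variable {E : Type*} [Fintype E]

/-- Stationary distributions of a transition matrix. -/
structure IsStationary (P : E → E → ℝ) (π : E → ℝ) : Prop where
  mem : π ∈ stdSimplex ℝ E
  balance : ∀ y, ∑ x, π x * P x y = π y

/-- Average of the laws in the slots `0, …, K`. -/
def occupation (p : ℕ → E → ℝ) (K : ℕ) : E → ℝ :=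
  fun e => (∑ k ∈ Finset.range (K + 1), p k e) / ((K : ℝ) + 1)

theorem occupation_mem_stdSimplex {p : ℕ → E → ℝ} (hp : ∀ k, p k ∈ stdSimplex ℝ E) (K : ℕ) :
    occupation p K ∈ stdSimplex ℝ E := by
  refine ⟨fun e => div_nonneg (Finset.sum_nonneg fun k _ => (hp k).1 e) (by positivity), ?_⟩
  simp only [occupation]
  rw [← Finset.sum_div, Finset.sum_comm, Finset.sum_congr rfl fun k _ => (hp k).2]
  have : (K : ℝ) + 1 ≠ 0 := by positivity
  simp [this]

/-- The balance defect of the average over the slots `0, …, K` telescopes to `(p (K + 1) - p 0) / (K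
+ 1)`, which tends to zero. -/
theorem isStationary_of_tendsto_occupation {P : E → E → ℝ} {p : ℕ → E → ℝ}
    (hp : ∀ k, p k ∈ stdSimplex ℝ E) (hstep : ∀ k y, p (k + 1) y = ∑ x, p k x * P x y)
    {φ : ℕ → ℕ} (hφ : StrictMono φ) {π : E → ℝ}
    (hπ : Tendsto (fun n => occupation p (φ n)) atTop (𝓝 π)) : IsStationary P π := by
  refine ⟨(isClosed_stdSimplex ℝ E).mem_of_tendsto hπ
    (Eventually.of_forall fun n => occupation_mem_stdSimplex hp _), fun y => ?_⟩
  have hπ' := fun x => tendsto_pi_nhds.1 hπ x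
  have h1 : Tendsto (fun n => ∑ x, occupation p (φ n) x * P x y) atTop (𝓝 (∑ x, π x * P x y)) :=
    tendsto_finsetSum _ fun x _ => (hπ' x).mul_const _
  have h2 : ∀ K, ∑ x, occupation p K x * P x y
      = occupation p K y + (p (K + 1) y - p 0 y) / ((K : ℝ) + 1) := by
    intro K
    simp only [occupation, div_mul_eq_mul_div]
    rw [← Finset.sum_div, ← add_div]
    congr 1
    simp only [Finset.sum_mul]
    rw [Finset.sum_comm, Finset.sum_congr rfl fun k _ => (hstep k y).symm]
    rw [Finset.sum_range_succ' (fun k => p k y), Finset.sum_range_succ (fun k => p (k + 1) y)]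
    ring
  have hle : ∀ k, p k y ≤ 1 := fun k => by
    rw [← (hp k).2]
    exact Finset.single_le_sum (fun x _ => (hp k).1 x) (Finset.mem_univ y)
  have h3 : Tendsto (fun K : ℕ => (p (K + 1) y - p 0 y) / ((K : ℝ) + 1)) atTop (𝓝 0) := by
    refine squeeze_zero_norm (a := fun K : ℕ => 1 / ((K : ℝ) + 1)) (fun K => ?_)
      tendsto_one_div_add_atTop_nhds_zero_nat
    rw [Real.norm_eq_abs, abs_div, abs_of_pos (by positivity : (0 : ℝ) < (K : ℝ) + 1)]
    gcongr
    rw [abs_le]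
    constructor <;> linarith [hle (K + 1), hle 0, (hp (K + 1)).1 y, (hp 0).1 y]
  have h4 := (hπ' y).add (h3.comp hφ.tendsto_atTop)
  rw [add_zero] at h4
  refine tendsto_nhds_unique h1 (h4.congr fun n => ?_)
  simp [h2]

theorem abs_sum_mul_le_of_mem_stdSimplex {m : E → ℝ} (hm : m ∈ stdSimplex ℝ E) (r : E → ℝ) :
    |∑ x, m x * r x| ≤ ∑ x, |r x| := by
  refine (Finset.abs_sum_le_sum_abs _ _).trans (Finset.sum_le_sum fun x _ => ?_)
  rw [abs_mul, abs_of_nonneg (hm.1 x)]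
  have : m x ≤ 1 := hm.2 ▸ Finset.single_le_sum (fun x _ => hm.1 x) (Finset.mem_univ x)
  exact mul_le_of_le_one_left (abs_nonneg _) this

theorem isBoundedUnder_occupation {p : ℕ → E → ℝ} (hp : ∀ k, p k ∈ stdSimplex ℝ E) (r : E → ℝ) :
    IsBoundedUnder (· ≤ ·) atTop (fun K => ∑ x, occupation p K x * r x) ∧
      IsBoundedUnder (· ≥ ·) atTop (fun K => ∑ x, occupation p K x * r x) := by
  have h := fun K => abs_le.1 (abs_sum_mul_le_of_mem_stdSimplex (occupation_mem_stdSimplex hp K) r)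
  exact ⟨isBoundedUnder_of ⟨_, fun K => (h K).2⟩, isBoundedUnder_of ⟨_, fun K => (h K).1⟩⟩

/-- The long-term average reward is at most the mean reward under some stationary distribution,
which charges only states that the chain visits. -/
theorem exists_isStationary_liminf_le {P : E → E → ℝ} {p : ℕ → E → ℝ}
    (hp : ∀ k, p k ∈ stdSimplex ℝ E) (hstep : ∀ k y, p (k + 1) y = ∑ x, p k x * P x y)
    (r : E → ℝ) :
    ∃ π, IsStationary P π ∧ (∀ x, π x ≠ 0 → ∃ k, p k x ≠ 0) ∧
      liminf (fun K => ∑ x, occupation p K x * r x) atTop ≤ ∑ x, π x * r x := by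
  obtain ⟨π, -, φ, hφ, hπ⟩ := (isCompact_stdSimplex ℝ E).tendsto_subseq
    (fun n => occupation_mem_stdSimplex hp n)
  refine ⟨π, isStationary_of_tendsto_occupation hp hstep hφ hπ, fun x hx => ?_, ?_⟩
  · by_contra! h
    refine hx (tendsto_nhds_unique (tendsto_pi_nhds.1 hπ x) ?_)
    simp [occupation, h]
  · have hlim : Tendsto (fun n => ∑ x, occupation p (φ n) x * r x) atTop
        (𝓝 (∑ x, π x * r x)) :=
      tendsto_finsetSum _ fun x _ => (tendsto_pi_nhds.1 hπ x).mul_const _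
    refine le_of_forall_lt fun a ha => ?_
    have h1 : ∀ᶠ K in atTop, a < ∑ x, occupation p K x * r x :=
      eventually_lt_of_lt_liminf ha (isBoundedUnder_occupation hp r).2
    by_contra! hcon
    obtain ⟨b, hab, hb⟩ := exists_between ha
    have h2 : ∀ᶠ K in atTop, b < ∑ x, occupation p K x * r x :=
      eventually_lt_of_lt_liminf hb (isBoundedUnder_occupation hp r).2
    have h3 := ge_of_tendsto hlim ((hφ.tendsto_atTop.eventually h2).mono fun _ => le_of_lt)
    linarith

/-- Otherwise the averages stay below some `a < g` along a subsequence; by compactness a further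
subsequence converges to a stationary distribution of mean at most `a`. -/
theorem le_liminf_of_forall_isStationary {P : E → E → ℝ} {p : ℕ → E → ℝ}
    (hp : ∀ k, p k ∈ stdSimplex ℝ E) (hstep : ∀ k y, p (k + 1) y = ∑ x, p k x * P x y)
    (r : E → ℝ) {g : ℝ} (hg : ∀ π, IsStationary P π → g ≤ ∑ x, π x * r x) :
    g ≤ liminf (fun K => ∑ x, occupation p K x * r x) atTop := by
  by_contra! hlt
  obtain ⟨a, ha, hag⟩ := exists_between hlt
  have hfreq : ∃ᶠ K in atTop, ∑ x, occupation p K x * r x < a :=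
    frequently_lt_of_liminf_lt (isBoundedUnder_occupation hp r).1.isCoboundedUnder_ge ha
  obtain ⟨φ, hφ, hφa⟩ := extraction_of_frequently_atTop hfreq
  obtain ⟨π, -, ψ, hψ, hπ⟩ := (isCompact_stdSimplex ℝ E).tendsto_subseq
    (fun n => occupation_mem_stdSimplex hp (φ n))
  have hlim : Tendsto (fun n => ∑ x, occupation p (φ (ψ n)) x * r x) atTop
      (𝓝 (∑ x, π x * r x)) :=
    tendsto_finsetSum _ fun x _ => (tendsto_pi_nhds.1 hπ x).mul_const _
  have h1 := hg π (isStationary_of_tendsto_occupation hp hstep (hφ.comp hψ) hπ)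
  have h2 := le_of_tendsto hlim (Eventually.of_forall fun n => (hφa (ψ n)).le)
  linarith

theorem IsStationary.pos_of_pos {P : E → E → ℝ} (hP : ∀ x y, 0 ≤ P x y) {π : E → ℝ}
    (h : IsStationary P π) {x y : E} (hx : 0 < π x) (hxy : 0 < P x y) : 0 < π y := by
  rw [← h.balance y]
  exact Finset.sum_pos' (fun z _ => mul_nonneg (h.mem.1 z) (hP z y))
    ⟨x, Finset.mem_univ x, mul_pos hx hxy⟩

theorem IsStationary.pos_of_reflTransGen {P : E → E → ℝ} (hP : ∀ x y, 0 ≤ P x y) {π : E → ℝ}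
    (h : IsStationary P π) {x y : E} (hx : 0 < π x)
    (hxy : Relation.ReflTransGen (fun a b => 0 < P a b) x y) : 0 < π y := by
  induction hxy with
  | refl => exact hx
  | tail _ hbc ih => exact h.pos_of_pos hP ih hbc

/-- A stationary distribution vanishes outside a closed set of states that can be reached from
everywhere. -/
theorem IsStationary.eq_zero_of_notMem {P : E → E → ℝ} (hP : ∀ x, P x ∈ stdSimplex ℝ E)
    {π : E → ℝ} (h : IsStationary P π) {C : Set E} (hC : ∀ x ∈ C, ∀ y, 0 < P x y → y ∈ C)
    (hreach : ∀ x, ∃ y ∈ C, Relation.ReflTransGen (fun a b => 0 < P a b) x y)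
    {x : E} (hx : x ∉ C) : π x = 0 := by
  classical
  -- In equilibrium the mass of `C` is constant and none of it leaves, so no mass can flow in from
  -- outside.
  have hexit : ∀ a, a ∉ C → 0 < π a → ∀ b, 0 < P a b → b ∉ C := by
    intro a ha hπa b hab hb
    have hbal : ∑ y with y ∈ C, π y = ∑ z, π z * ∑ y with y ∈ C, P z y := by
      rw [Finset.sum_congr rfl fun y _ => (h.balance y).symm, Finset.sum_comm]
      simp only [Finset.mul_sum]
    have hin : ∀ z ∈ C, ∑ y with y ∈ C, P z y = 1 := by
      intro z hz
      rw [← (hP z).2]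
      refine Finset.sum_subset (Finset.filter_subset _ _) fun y _ hy => ?_
      by_contra hne
      exact hy (by simpa using hC z hz y (lt_of_le_of_ne ((hP z).1 y) (Ne.symm hne)))
    rw [← Finset.sum_filter_add_sum_filter_not Finset.univ (· ∈ C)
      (fun z => π z * ∑ y with y ∈ C, P z y)] at hbal
    rw [Finset.sum_congr (s₁ := Finset.univ.filter (· ∈ C)) (g := π) rfl
      (f := fun z => π z * ∑ y with y ∈ C, P z y)
      fun z hz => by rw [hin z (by simpa using hz), mul_one]] at hbal
    have hpos : 0 < ∑ z with z ∉ C, π z * ∑ y with y ∈ C, P z y := by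
      refine Finset.sum_pos' (fun z _ => mul_nonneg (h.mem.1 z)
        (Finset.sum_nonneg fun y _ => (hP z).1 y)) ⟨a, by simpa using ha, mul_pos hπa ?_⟩
      exact Finset.sum_pos' (fun y _ => (hP a).1 y) ⟨b, by simpa using hb, hab⟩
    linarith
  by_contra hne
  have hpos : 0 < π x := lt_of_le_of_ne (h.mem.1 x) (Ne.symm hne)
  obtain ⟨y, hyC, hxy⟩ := hreach x
  have : y ∉ C ∧ 0 < π y := by
    clear hyC hne
    induction hxy with
    | refl => exact ⟨hx, hpos⟩
    | tail _ hbc ih =>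
      exact ⟨hexit _ ih.1 ih.2 _ hbc, h.pos_of_pos (fun x y => (hP x).1 y) ih.2 hbc⟩
  exact this.1 hyC

/-- If `r + P h = g + h` holds on a closed set of states that can be reached from everywhere, then
`r` has mean `g` under every stationary distribution. -/
theorem IsStationary.sum_eq_of_closed {P : E → E → ℝ} (hP : ∀ x, P x ∈ stdSimplex ℝ E)
    {π : E → ℝ} (h : IsStationary P π) {C : Set E} (hC : ∀ x ∈ C, ∀ y, 0 < P x y → y ∈ C)
    (hreach : ∀ x, ∃ y ∈ C, Relation.ReflTransGen (fun a b => 0 < P a b) x y)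
    {r f : E → ℝ} {g : ℝ} (hg : ∀ x ∈ C, r x + ∑ y, P x y * f y = g + f x) :
    ∑ x, π x * r x = g := by
  have h1 : ∑ x, π x * (r x + ∑ y, P x y * f y) = ∑ x, π x * (g + f x) := by
    refine Finset.sum_congr rfl fun x _ => ?_
    by_cases hx : x ∈ C
    · rw [hg x hx]
    · rw [h.eq_zero_of_notMem hP hC hreach hx, zero_mul, zero_mul]
  have h2 : ∑ x, π x * ∑ y, P x y * f y = ∑ y, π y * f y := by
    simp only [Finset.mul_sum]
    rw [Finset.sum_comm]
    refine Finset.sum_congr rfl fun y _ => ?_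
    rw [← h.balance y, Finset.sum_mul]
    exact Finset.sum_congr rfl fun x _ => by ring
  simp only [mul_add, Finset.sum_add_distrib, h2, ← Finset.sum_mul, h.mem.2] at h1
  linarith

/-- With the gaps `g + h - r - P h` the mean reward is `g` minus the mean gap. -/
theorem IsStationary.sum_eq_sub {P : E → E → ℝ}
    {π : E → ℝ} (h : IsStationary P π) (r f : E → ℝ) (g : ℝ) :
    ∑ x, π x * r x = g - ∑ x, π x * (g + f x - r x - ∑ y, P x y * f y) := by
  have h2 : ∑ x, π x * ∑ y, P x y * f y = ∑ y, π y * f y := by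
    simp only [Finset.mul_sum]
    rw [Finset.sum_comm]
    refine Finset.sum_congr rfl fun y _ => ?_
    rw [← h.balance y, Finset.sum_mul]
    exact Finset.sum_congr rfl fun x _ => by ring
  simp only [mul_sub, mul_add, Finset.sum_sub_distrib, Finset.sum_add_distrib, h2,
    ← Finset.sum_mul, h.mem.2]
  ring

/-- From every state of a finite chain a recurrent one can be reached. -/
theorem exists_reflTransGen_recurrent (R : E → E → Prop) (x : E) :
    ∃ y, Relation.ReflTransGen R x y ∧
      ∀ z, Relation.ReflTransGen R y z → Relation.ReflTransGen R z y := by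
  classical
  -- A state with the fewest successors: every `z` reachable from it has the same set of successors,
  -- which contains `y`.
  obtain ⟨y, hy, hmin⟩ := Finset.exists_min_image
    (Finset.univ.filter fun y => Relation.ReflTransGen R x y)
    (fun y => (Finset.univ.filter fun z => Relation.ReflTransGen R y z).card)
    ⟨x, by simpa using Relation.ReflTransGen.refl⟩
  simp only [Finset.mem_filter, Finset.mem_univ, true_and] at hy hmin
  refine ⟨y, hy, fun z hz => ?_⟩
  have hsub : (Finset.univ.filter fun w => Relation.ReflTransGen R z w) ⊆
      Finset.univ.filter fun w => Relation.ReflTransGen R y w := by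
    intro w hw
    simp only [Finset.mem_filter, Finset.mem_univ, true_and] at hw ⊢
    exact hz.trans hw
  have heq := Finset.eq_of_subset_of_card_le hsub (hmin z (hy.trans hz))
  have : y ∈ Finset.univ.filter fun w => Relation.ReflTransGen R z w := by
    rw [heq]
    simpa using Relation.ReflTransGen.refl
  simpa using this

end MarkovChain

/-! ### The optimally split rate: Lipschitz bound and the meaning of the sign of `D`. -/

section

theorem abs_log_one_add_mul_sub_le {a p q : ℝ} (ha : 0 ≤ a) (hp : 0 ≤ p) (hq : 0 ≤ q) :
    |Real.log (1 + a * p) - Real.log (1 + a * q)| ≤ a * |p - q| := by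
  wlog hpq : q ≤ p generalizing p q
  · rw [abs_sub_comm, abs_sub_comm p]
    exact this hq hp (le_of_not_ge hpq)
  have h1 : 0 < 1 + a * q := by positivity
  have h2 : 0 < 1 + a * p := by positivity
  have h3 : a * q ≤ a * p := by gcongr
  rw [abs_of_nonneg (sub_nonneg.2 (Real.log_le_log h1 (by linarith))),
    abs_of_nonneg (sub_nonneg.2 hpq), ← Real.log_div h2.ne' h1.ne']
  refine (Real.log_le_sub_one_of_pos (div_pos h2 h1)).trans ?_
  rw [div_sub_one h1.ne', div_le_iff₀ h1]
  have : 0 ≤ a * (p - q) := mul_nonneg ha (sub_nonneg.2 hpq)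
  nlinarith [mul_nonneg ha hq]

theorem abs_subRate_sub_le (κ : Coding) {g h p q : ℝ} (hg : 0 ≤ g) (hh : 0 ≤ h) (hp : 0 ≤ p)
    (hq : 0 ≤ q) : |subRate κ g h p - subRate κ g h q| ≤ (g + h) * |p - q| := by
  have key : ∀ a, 0 ≤ a → a ≤ h → |(Real.log (1 + g * p) - Real.log (1 + a * p))
      - (Real.log (1 + g * q) - Real.log (1 + a * q))| ≤ (g + h) * |p - q| := by
    intro a ha hah
    have h1 := abs_log_one_add_mul_sub_le hg hp hq
    have h2 := abs_log_one_add_mul_sub_le ha hp hq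
    have h3 : a * |p - q| ≤ h * |p - q| := by gcongr
    rw [sub_sub_sub_comm]
    refine (abs_sub _ _).trans ?_
    linarith
  cases κ
  · exact key _ (le_min hg hh) (min_le_right _ _)
  · exact key _ hh le_rfl

/-- A Lipschitz constant of the secrecy rate in the channel state `s`. -/
def rateBound {N : ℕ} (s : ChannelState N) : ℝ := ∑ r, (s.1 r + s.2 r)

variable {N : ℕ}

theorem rateBound_nonneg {s : ChannelState N} (hs : ∀ r, 0 ≤ s.1 r ∧ 0 ≤ s.2 r) :
    0 ≤ rateBound s :=
  Finset.sum_nonneg fun r _ => add_nonneg (hs r).1 (hs r).2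

theorem abs_rate_sub_le (κ : Coding) {s : ChannelState N} (hs : ∀ r, 0 ≤ s.1 r ∧ 0 ≤ s.2 r)
    {ρ τ : Fin N → ℝ} (hρ : ∀ r, 0 ≤ ρ r) (hτ : ∀ r, 0 ≤ τ r) :
    |rate κ ρ s - rate κ τ s| ≤ rateBound s * ∑ r, |ρ r - τ r| := by
  rw [rate, rate, ← Finset.sum_sub_distrib, Finset.mul_sum]
  refine (Finset.abs_sum_le_sum_abs _ _).trans (Finset.sum_le_sum fun r _ => ?_)
  refine (abs_subRate_sub_le κ (hs r).1 (hs r).2 (hρ r) (hτ r)).trans ?_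
  have : s.1 r + s.2 r ≤ rateBound s :=
    Finset.single_le_sum (f := fun r => s.1 r + s.2 r)
      (fun i _ => add_nonneg (hs i).1 (hs i).2) (Finset.mem_univ r)
  gcongr

theorem rate_zero (κ : Coding) (s : ChannelState N) : rate κ 0 s = 0 := by
  cases κ <;> simp [rate, subRate]

theorem abs_rate_le (κ : Coding) {s : ChannelState N} (hs : ∀ r, 0 ≤ s.1 r ∧ 0 ≤ s.2 r)
    {ρ : Fin N → ℝ} (hρ : ∀ r, 0 ≤ ρ r) : |rate κ ρ s| ≤ rateBound s * ∑ r, ρ r := by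
  have := abs_rate_sub_le κ hs hρ (τ := 0) (fun _ => le_rfl)
  simpa [rate_zero, abs_of_nonneg (hρ _)] using this

theorem rate_le_optRate (hN : 0 < N) (κ : Coding) {s : ChannelState N}
    (hs : ∀ r, 0 ≤ s.1 r ∧ 0 ≤ s.2 r) {x : ℝ} {ρ : Fin N → ℝ} (hρ : ρ ∈ splits N x) :
    rate κ ρ s ≤ optRate κ s x := by
  have hx : 0 ≤ x := hρ.2 ▸ Finset.sum_nonneg fun r _ => hρ.1 r
  obtain ⟨τ, -, hmax, h⟩ := exists_optimal_split hN κ s hs hx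
  exact h ▸ hmax hρ

theorem optRate_zero (hN : 0 < N) (κ : Coding) {s : ChannelState N}
    (hs : ∀ r, 0 ≤ s.1 r ∧ 0 ≤ s.2 r) : optRate κ s 0 = 0 := by
  obtain ⟨τ, hτ, -, h⟩ := exists_optimal_split hN κ s hs le_rfl
  have : τ = 0 := by
    funext r
    exact (Finset.sum_eq_zero_iff_of_nonneg fun r _ => hτ.1 r).1 hτ.2 r (Finset.mem_univ r)
  rw [h, this, rate_zero]

/-- Rescaling by `y / x` moves every coordinate in the same direction, so the distance is the
difference of the totals. For `x = 0` all power goes to one sub-carrier. -/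
theorem exists_mem_splits_sum_abs_sub (hN : 0 < N) {x y : ℝ} (hy : 0 ≤ y) {ρ : Fin N → ℝ}
    (hρ : ρ ∈ splits N x) : ∃ τ ∈ splits N y, ∑ r, |ρ r - τ r| = |x - y| := by
  obtain ⟨h0, h1⟩ := hρ
  have hx : 0 ≤ x := h1 ▸ Finset.sum_nonneg fun r _ => h0 r
  rcases hx.eq_or_lt with rfl | hx
  · have hz : ∀ r, ρ r = 0 := fun r =>
      (Finset.sum_eq_zero_iff_of_nonneg fun r _ => h0 r).1 h1 r (Finset.mem_univ r)
    refine ⟨Pi.single ⟨0, hN⟩ y, ⟨fun r => ?_, by simp⟩, ?_⟩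
    · by_cases h : r = ⟨0, hN⟩
      · subst h; simpa using hy
      · simp [h]
    · simp only [hz, zero_sub, abs_neg]
      rw [Finset.sum_eq_single ⟨0, hN⟩] <;> simp +contextual
  · refine ⟨fun r => y / x * ρ r, ⟨fun r => mul_nonneg (div_nonneg hy hx.le) (h0 r), ?_⟩, ?_⟩
    · rw [← Finset.mul_sum, h1, div_mul_cancel₀ _ hx.ne']
    · have : ∀ r, |ρ r - y / x * ρ r| = |1 - y / x| * ρ r := fun r => by
        rw [← abs_of_nonneg (h0 r), ← abs_mul, abs_of_nonneg (h0 r)]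
        congr 1
        ring
      simp only [this]
      rw [← Finset.mul_sum, h1]
      nth_rewrite 2 [← abs_of_pos hx]
      rw [← abs_mul]
      congr 1
      field_simp

theorem optRate_sub_le (hN : 0 < N) (κ : Coding) {s : ChannelState N}
    (hs : ∀ r, 0 ≤ s.1 r ∧ 0 ≤ s.2 r) {x y : ℝ} (hx : 0 ≤ x) (hy : 0 ≤ y) :
    optRate κ s x - optRate κ s y ≤ rateBound s * |x - y| := by
  obtain ⟨ρ, hρ, -, h⟩ := exists_optimal_split hN κ s hs hx
  obtain ⟨τ, hτ, hd⟩ := exists_mem_splits_sum_abs_sub hN hy hρ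
  have h1 := rate_le_optRate hN κ hs hτ
  have h2 := (abs_le.1 (abs_rate_sub_le κ hs hρ.1 hτ.1)).2
  rw [hd] at h2
  linarith

theorem lipschitzOnWith_optRate (hN : 0 < N) (κ : Coding) {s : ChannelState N}
    (hs : ∀ r, 0 ≤ s.1 r ∧ 0 ≤ s.2 r) :
    LipschitzOnWith (rateBound s).toNNReal (optRate κ s) (Set.Ici 0) := by
  refine LipschitzOnWith.of_dist_le_mul fun x hx y hy => ?_
  rw [Real.coe_toNNReal _ (rateBound_nonneg hs), Real.dist_eq, Real.dist_eq, abs_le]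
  have h1 := optRate_sub_le hN κ hs hx hy
  have h2 := optRate_sub_le hN κ hs hy hx
  rw [abs_sub_comm y x] at h2
  constructor <;> linarith

/-- A Lipschitz function whose derivative is nonnegative (where it exists) is monotone. -/
theorem monotoneOn_of_lipschitzOnWith_of_deriv_nonneg {f : ℝ → ℝ} {K : NNReal} {a b : ℝ}
    (hf : LipschitzOnWith K f (Set.Icc a b)) (hd : ∀ x ∈ Set.Ioo a b, 0 ≤ deriv f x) :
    MonotoneOn f (Set.Icc a b) := by
  intro x hx y hy hxy
  have hsub : Set.uIcc x y ⊆ Set.Icc a b := by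
    rw [Set.uIcc_of_le hxy]
    exact Set.Icc_subset_Icc hx.1 hy.2
  -- Absolute continuity gives back the increment as the integral of `deriv f`. The default value
  -- `0` at points without a derivative agrees with the sign condition.
  have hac := (hf.mono hsub).absolutelyContinuousOnInterval
  have h := hac.integral_deriv_eq_sub
  have h0 : 0 ≤ ∫ t in x..y, deriv f t := by
    rw [intervalIntegral.integral_of_le hxy, MeasureTheory.integral_Ioc_eq_integral_Ioo]
    exact MeasureTheory.setIntegral_nonneg measurableSet_Ioo fun t ht =>
      hd t ⟨hx.1.trans_lt ht.1, ht.2.trans_le hy.2⟩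
  linarith

theorem monotoneOn_optRate_sub (hN : 0 < N) (κ : Coding) {s' s'' : ChannelState N}
    (hs' : ∀ r, 0 ≤ s'.1 r ∧ 0 ≤ s'.2 r) (hs'' : ∀ r, 0 ≤ s''.1 r ∧ 0 ≤ s''.2 r) {b : ℝ}
    (hD : ∀ x ∈ Set.Ioo 0 b, 0 ≤ D κ s' s'' x) :
    MonotoneOn (fun y => optRate κ s'' y - optRate κ s' y) (Set.Icc 0 b) :=
  monotoneOn_of_lipschitzOnWith_of_deriv_nonneg
    (((lipschitzOnWith_optRate hN κ hs'').sub (lipschitzOnWith_optRate hN κ hs')).mono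
      fun _ hx => hx.1) hD

theorem D_swap (κ : Coding) (s' s'' : ChannelState N) (x : ℝ) :
    D κ s'' s' x = - D κ s' s'' x := by
  rw [D, D, ← deriv.fun_neg]
  simp only [neg_sub]

/-- If the difference of the optimally split rates is monotone and takes the same value at two
points, its derivative vanishes in between. -/
theorem D_eq_zero_of_monotoneOn {κ : Coding} {s' s'' : ChannelState N} {a b : ℝ}
    (hm : MonotoneOn (fun y => optRate κ s'' y - optRate κ s' y) (Set.Icc a b))
    (hab : optRate κ s'' b - optRate κ s' b ≤ optRate κ s'' a - optRate κ s' a)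
    {x : ℝ} (hx : x ∈ Set.Ioo a b) : D κ s' s'' x = 0 := by
  have hle : a ≤ b := (hx.1.trans hx.2).le
  have : (fun y => optRate κ s'' y - optRate κ s' y) =ᶠ[𝓝 x]
      fun _ => optRate κ s'' a - optRate κ s' a := by
    filter_upwards [Ioo_mem_nhds hx.1 hx.2] with y hy
    have hy' := Set.Ioo_subset_Icc_self hy
    exact le_antisymm ((hm hy' (Set.right_mem_Icc.2 hle) hy'.2).trans hab)
      (hm (Set.left_mem_Icc.2 hle) hy' hy'.1)
  rw [D, this.deriv_eq, deriv_const]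

end

/-! ### Expectations under discrete laws, and the mean over the next battery level. -/

section

theorem sum_toReal_pmf {α : Type*} [Fintype α] (p : PMF α) : ∑ a, (p a).toReal = 1 := by
  rw [← ENNReal.toReal_sum fun a _ => p.apply_ne_top a, ← tsum_fintype (L := .unconditional α),
    p.tsum_coe, ENNReal.toReal_one]

theorem toReal_pmf_mem_stdSimplex {α : Type*} [Fintype α] (p : PMF α) :
    (fun a => (p a).toReal) ∈ stdSimplex ℝ α :=
  ⟨fun _ => ENNReal.toReal_nonneg, sum_toReal_pmf p⟩

theorem summable_toReal_pmf {α : Type*} (p : PMF α) : Summable fun a => (p a).toReal :=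
  ENNReal.summable_toReal (by rw [p.tsum_coe]; exact ENNReal.one_ne_top)

theorem tsum_toReal_pmf {α : Type*} (p : PMF α) : ∑' a, (p a).toReal = 1 := by
  rw [← ENNReal.tsum_toReal_eq fun a => p.apply_ne_top a, p.tsum_coe, ENNReal.toReal_one]

theorem toReal_pmf_pos {α : Type*} {p : PMF α} {a : α} : 0 < (p a).toReal ↔ p a ≠ 0 := by
  rw [ENNReal.toReal_pos_iff, pos_iff_ne_zero]
  exact ⟨fun h => h.1, fun h => ⟨h, (p.apply_ne_top a).lt_top⟩⟩

theorem summable_toReal_pmf_mul {α : Type*} (p : PMF α) {f : α → ℝ} {C : ℝ}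
    (hf : ∀ a, |f a| ≤ C) : Summable fun a => (p a).toReal * f a := by
  refine Summable.of_norm_bounded ((summable_toReal_pmf p).mul_right C) fun a => ?_
  rw [Real.norm_eq_abs, abs_mul, abs_of_nonneg ENNReal.toReal_nonneg]
  exact mul_le_mul_of_nonneg_left (hf a) ENNReal.toReal_nonneg

theorem tsum_toReal_pmf_mul_le {α : Type*} (p : PMF α) {f : α → ℝ} {C c : ℝ}
    (hf : ∀ a, |f a| ≤ C) (hc : ∀ a, f a ≤ c) : ∑' a, (p a).toReal * f a ≤ c := by
  rw [← one_mul c, ← tsum_toReal_pmf p, ← tsum_mul_right]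
  exact (summable_toReal_pmf_mul p hf).tsum_le_tsum
    (fun a => mul_le_mul_of_nonneg_left (hc a) ENNReal.toReal_nonneg)
    ((summable_toReal_pmf p).mul_right c)

theorem tsum_toReal_pure_mul {α : Type*} (a : α) (f : α → ℝ) :
    ∑' x, (PMF.pure a x).toReal * f x = f a := by
  rw [tsum_eq_single a fun x hx => by simp [PMF.pure_apply, hx]]
  simp [PMF.pure_apply]

theorem sum_bind_toReal_mul {α β : Type*} [Fintype β] (p : PMF α) (k : α → PMF β) (f : β → ℝ) :
    ∑ b, (p.bind k b).toReal * f b = ∑' a, (p a).toReal * ∑ b, (k a b).toReal * f b := by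
  have h1 : ∀ b a, p a * k a b ≠ ⊤ := fun b a =>
    ENNReal.mul_ne_top (p.apply_ne_top a) ((k a).apply_ne_top b)
  have h2 : ∀ b, (p.bind k b).toReal = ∑' a, (p a).toReal * (k a b).toReal := fun b => by
    rw [PMF.bind_apply, ENNReal.tsum_toReal_eq (h1 b)]
    simp only [ENNReal.toReal_mul]
  have h3 : ∀ b, Summable fun a => (p a).toReal * ((k a b).toReal * f b) := fun b => by
    refine summable_toReal_pmf_mul p (C := |f b|) fun a => ?_
    rw [abs_mul, abs_of_nonneg ENNReal.toReal_nonneg]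
    exact mul_le_of_le_one_left (abs_nonneg _)
      (ENNReal.toReal_le_of_le_ofReal zero_le_one (by simpa using (k a).coe_le_one b))
  simp only [h2, ← tsum_mul_right, Finset.mul_sum, mul_assoc]
  exact (Summable.tsum_finsetSum fun b _ => h3 b).symm

theorem sum_map_toReal_mul {α β : Type*} [Fintype α] [Fintype β] (p : PMF α) (k : α → β)
    (f : β → ℝ) : ∑ b, (p.map k b).toReal * f b = ∑ a, (p a).toReal * f (k a) := by
  rw [PMF.map, sum_bind_toReal_mul, tsum_fintype]
  refine Finset.sum_congr rfl fun a _ => ?_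
  rw [← tsum_fintype (L := .unconditional β)]
  simp only [Function.comp]
  rw [tsum_toReal_pure_mul]

variable {N : ℕ}

/-- Law of the number of harvested energy quanta, capped at the battery size. -/
def Model.cappedArrival (M : Model N) : PMF M.Energy :=
  M.arrivalLaw.map fun b => ⟨min b M.emax, Nat.lt_succ_of_le (min_le_right _ _)⟩

theorem Model.update_min (M : Model N) (e : M.Energy) (x b : ℕ) :
    M.update e x (min b M.emax) = M.update e x b := by
  simp only [Model.update, Fin.mk.injEq]
  omega

/-- Quanta beyond the battery size are lost anyway; with capped arrivals all means over arrivals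
become finite sums. -/
theorem Model.map_cappedArrival (M : Model N) (e : M.Energy) (x : ℕ) :
    M.cappedArrival.map (fun b : M.Energy => M.update e x b) = M.arrivalLaw.map fun b => M.update e x b := by
  rw [Model.cappedArrival, PMF.map_comp]
  congr 1
  funext b
  exact M.update_min e x b

/-- Mean of `h` at the next energy level, if `x` quanta are used at level `e`. -/
def Model.nextMean (M : Model N) (h : M.Energy → ℝ) (e : M.Energy) (x : ℕ) : ℝ :=
  ∑ b : M.Energy, (M.cappedArrival b).toReal * h (M.update e x b)

theorem Model.sum_map_arrivalLaw (M : Model N) (h : M.Energy → ℝ) (e : M.Energy) (x : ℕ) :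
    ∑ y, ((M.arrivalLaw.map fun b => M.update e x b) y).toReal * h y = M.nextMean h e x := by
  rw [← M.map_cappedArrival, sum_map_toReal_mul, Model.nextMean]

theorem Model.nextMean_le_add (M : Model N) {h h' : M.Energy → ℝ} {e e' : M.Energy} {x : ℕ} {c : ℝ}
    (H : ∀ b : ℕ, h (M.update e x b) ≤ h' (M.update e' x b) + c) :
    M.nextMean h e x ≤ M.nextMean h' e' x + c := by
  rw [Model.nextMean, Model.nextMean, ← one_mul c, ← sum_toReal_pmf M.cappedArrival,
    Finset.sum_mul, ← Finset.sum_add_distrib]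
  refine Finset.sum_le_sum fun b _ => ?_
  rw [← mul_add]
  exact mul_le_mul_of_nonneg_left (H b) ENNReal.toReal_nonneg

/-! ### Discounted optimality equations and their vanishing-discount limit. -/

/-- Right-hand side of the (discounted) optimality equation, for the rewards `r`. -/
def Model.bellman (M : Model N) (r : M.channels → ℕ → ℝ) (β : ℝ) (h : M.Energy → ℝ)
    (e : M.Energy) : ℝ :=
  ∑ s, (M.channelLaw s).toReal *
    (Finset.range (e + 1)).sup' Finset.nonempty_range_add_one fun x => r s x + β * M.nextMean h e x

variable {M : Model N} {r : M.channels → ℕ → ℝ}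

/-- Every action available at `e` is available at `e'`. With `e = e'` this comparison yields the
contraction property and the effect of constants; with `h = h'` it yields monotonicity in the energy
level. -/
theorem Model.bellman_le_add {β : ℝ} (hβ : 0 ≤ β) {h h' : M.Energy → ℝ} {e e' : M.Energy}
    (hee : e ≤ e') {c : ℝ} (H : ∀ x ≤ (e : ℕ), M.nextMean h e x ≤ M.nextMean h' e' x + c) :
    M.bellman r β h e ≤ M.bellman r β h' e' + β * c := by
  rw [Model.bellman, Model.bellman, ← one_mul (β * c), ← sum_toReal_pmf M.channelLaw,
    Finset.sum_mul, ← Finset.sum_add_distrib]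
  refine Finset.sum_le_sum fun s _ => ?_
  rw [← mul_add]
  refine mul_le_mul_of_nonneg_left (Finset.sup'_le _ _ fun x hx => ?_) ENNReal.toReal_nonneg
  have hx' : x ≤ (e : ℕ) := Nat.lt_succ_iff.1 (Finset.mem_range.1 hx)
  have h1 := Finset.le_sup' (fun x => r s x + β * M.nextMean h' e' x)
    (Finset.mem_range.2 (Nat.lt_succ_of_le (hx'.trans (Fin.le_def.1 hee))))
  have h2 := mul_le_mul_of_nonneg_left (H x hx') hβ
  linarith

theorem Model.bellman_sub_const {β : ℝ} (hβ : 0 ≤ β) (h : M.Energy → ℝ) (c : ℝ) (e : M.Energy) :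
    M.bellman r β (fun y => h y - c) e = M.bellman r β h e - β * c := by
  have h1 := Model.bellman_le_add (r := r) hβ (le_refl e) (h := fun y => h y - c) (h' := h)
    (c := -c) fun x _ => M.nextMean_le_add fun b => le_of_eq (by ring)
  have h2 := Model.bellman_le_add (r := r) hβ (le_refl e) (h' := fun y => h y - c) (h := h)
    (c := c) fun x _ => M.nextMean_le_add fun b => le_of_eq (by ring)
  linarith

theorem Model.exists_bellman_eq (r : M.channels → ℕ → ℝ) {β : ℝ} (hβ : 0 ≤ β) (hβ1 : β < 1) :
    ∃ V : M.Energy → ℝ, M.bellman r β V = V := by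
  lift β to NNReal using hβ
  have hβ : (0 : ℝ) ≤ β := β.2
  have hc : ContractingWith β (M.bellman r β) := by
    refine ⟨by exact_mod_cast hβ1, LipschitzWith.of_dist_le_mul fun h h' => ?_⟩
    have key : ∀ h h' : M.Energy → ℝ, ∀ e,
        M.bellman r β h e ≤ M.bellman r β h' e + β * dist h h' := fun h h' e =>
      Model.bellman_le_add hβ le_rfl fun x _ => M.nextMean_le_add fun b => by
        have := (abs_le.1 ((Real.dist_eq _ _).symm.le.trans
          (dist_le_pi_dist h h' (M.update e x b)))).2
        linarith
    refine (dist_pi_le_iff (by positivity)).2 fun e => ?_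
    rw [Real.dist_eq, abs_le]
    have h1 := key h h' e
    have h2 := key h' h e
    rw [dist_comm h' h] at h2
    constructor <;> linarith
  exact ⟨_, hc.fixedPoint_isFixedPt⟩

section Discounted

variable {β : ℝ} {V : M.Energy → ℝ}

/-- Let `c` be the largest value of `V a - V b` over `a ≤ b`. Updates preserve the order of levels,
so the fixed point equation gives `c ≤ β * c`, hence `c ≤ 0`. -/
theorem Model.monotone_of_bellman_eq (hβ : 0 ≤ β) (hβ1 : β < 1) (hV : M.bellman r β V = V) :
    Monotone V := by
  obtain ⟨⟨a, b⟩, hab, hmax⟩ := Finset.exists_max_image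
    (Finset.univ.filter fun p : M.Energy × M.Energy => p.1 ≤ p.2) (fun p => V p.1 - V p.2)
    ⟨(0, 0), by simp⟩
  simp only [Finset.mem_filter, Finset.mem_univ, true_and] at hab hmax
  have h := Model.bellman_le_add (r := r) hβ hab (h := V) (h' := V) (c := V a - V b) fun x _ =>
    M.nextMean_le_add fun y => by
      have := hmax (M.update a x y, M.update b x y) (by
        have := Fin.le_def.1 hab
        simp only [Model.update, Fin.mk_le_mk]
        omega)
      simp only at this
      linarith
  rw [hV] at h
  have h0 : V a - V b ≤ 0 := by nlinarith
  intro e e' hee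
  have := hmax (e, e') hee
  simp only at this
  linarith

theorem Model.mul_nextMean_zero_le (hr0 : ∀ s, r s 0 = 0) (hV : M.bellman r β V = V)
    (e : M.Energy) : β * M.nextMean V e 0 ≤ V e := by
  conv_rhs => rw [← hV, Model.bellman]
  rw [← one_mul (β * _), ← sum_toReal_pmf M.channelLaw, Finset.sum_mul]
  refine Finset.sum_le_sum fun s _ => mul_le_mul_of_nonneg_left ?_ ENNReal.toReal_nonneg
  have := Finset.le_sup' (fun x => r s x + β * M.nextMean V e x)
    (Finset.mem_range.2 (Nat.succ_pos (e : ℕ)))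
  rwa [hr0, zero_add] at this

theorem Model.nonneg_of_bellman_eq (hr0 : ∀ s, r s 0 = 0) (hβ : 0 ≤ β) (hβ1 : β < 1)
    (hV : M.bellman r β V = V) (e : M.Energy) : 0 ≤ V e := by
  have hmono := Model.monotone_of_bellman_eq hβ hβ1 hV
  have h1 := Model.mul_nextMean_zero_le hr0 hV 0
  have h2 : V 0 ≤ M.nextMean V 0 0 := by
    have := M.nextMean_le_add (h := fun _ => V 0) (h' := V) (e := 0) (e' := 0) (x := 0) (c := 0)
      fun b => by simpa using hmono (Fin.zero_le _)
    simpa [Model.nextMean, ← Finset.sum_mul, sum_toReal_pmf] using this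
  have h3 : 0 ≤ V 0 := by nlinarith
  exact h3.trans (hmono (Fin.zero_le e))

theorem Model.one_sub_mul_le_of_bellman_eq {R : ℝ} (hR : ∀ s, ∀ x ≤ M.emax, r s x ≤ R)
    (hβ : 0 ≤ β) (hβ1 : β < 1) (hV : M.bellman r β V = V) (e : M.Energy) :
    (1 - β) * V e ≤ R := by
  obtain ⟨a, -, ha⟩ := Finset.exists_max_image Finset.univ V ⟨e, Finset.mem_univ e⟩
  have h1 : V a ≤ R + β * V a := by
    conv_lhs => rw [← hV, Model.bellman]
    rw [← one_mul (R + β * _), ← sum_toReal_pmf M.channelLaw, Finset.sum_mul]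
    refine Finset.sum_le_sum fun s _ => mul_le_mul_of_nonneg_left
      (Finset.sup'_le _ _ fun x hx => ?_) ENNReal.toReal_nonneg
    have hx' : x ≤ M.emax := (Nat.lt_succ_iff.1 (Finset.mem_range.1 hx)).trans
      (Nat.lt_succ_iff.1 a.2)
    have h2 : M.nextMean V a x ≤ V a := by
      have := M.nextMean_le_add (h := V) (h' := fun _ => V a) (e := a) (e' := a) (x := x) (c := 0)
        fun b => by simpa using ha _ (Finset.mem_univ _)
      simpa [Model.nextMean, ← Finset.sum_mul, sum_toReal_pmf] using this
    exact add_le_add (hR s x hx') (mul_le_mul_of_nonneg_left h2 hβ)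
  have h2 := ha e (Finset.mem_univ e)
  have h3 : (1 - β) * V e ≤ (1 - β) * V a := mul_le_mul_of_nonneg_left h2 (by linarith)
  linarith

/-- Probability that at least one energy quantum is harvested and stored. -/
def Model.chargeProb (M : Model N) : ℝ := 1 - (M.cappedArrival 0).toReal

/-- Using no power for one slot at `e` leads to level `e + 1` or higher with probability
`chargeProb`. Hence `β * chargeProb * (V e' - V e)` is at most `(1 - β) * V e`, which is bounded by
`R` uniformly in `β`. -/
theorem Model.sub_le_of_bellman_eq (hr0 : ∀ s, r s 0 = 0) {R : ℝ}
    (hR : ∀ s, ∀ x ≤ M.emax, r s x ≤ R) (hβ : 0 ≤ β) (hβ1 : β < 1)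
    (hV : M.bellman r β V = V) {e e' : M.Energy} (he : (e' : ℕ) = e + 1) :
    β * M.chargeProb * (V e' - V e) ≤ R := by
  have hmono := Model.monotone_of_bellman_eq hβ hβ1 hV
  have h1 := Model.mul_nextMean_zero_le hr0 hV e
  have h2 : V e + M.chargeProb * (V e' - V e) ≤ M.nextMean V e 0 := by
    have hq : V e + M.chargeProb * (V e' - V e) = ∑ b, (M.cappedArrival b).toReal *
        (V e' + if b = 0 then V e - V e' else 0) := by
      simp only [mul_add, Finset.sum_add_distrib, ← Finset.sum_mul, sum_toReal_pmf, mul_ite,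
        mul_zero, Finset.sum_ite_eq', Finset.mem_univ, if_true, Model.chargeProb]
      ring
    rw [hq, Model.nextMean]
    refine Finset.sum_le_sum fun b _ => mul_le_mul_of_nonneg_left ?_ ENNReal.toReal_nonneg
    split_ifs with hb
    · rw [add_sub_cancel]
      refine hmono ?_
      have := e.2
      rw [Fin.le_def]
      simp only [Model.update]
      omega
    · rw [add_zero]
      refine hmono ?_
      have h3 := e'.2
      have h4 : (b : ℕ) ≠ 0 := fun h => hb (Fin.ext h)
      rw [Fin.le_def]
      simp only [Model.update]
      omega
  have h3 := Model.one_sub_mul_le_of_bellman_eq hR hβ hβ1 hV e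
  have h4 := mul_le_mul_of_nonneg_left h2 hβ
  nlinarith

theorem Model.chargeProb_pos (h0 : M.emax ≠ 0) (hB : ∃ b, 0 < b ∧ M.arrivalLaw b ≠ 0) :
    0 < M.chargeProb := by
  obtain ⟨b, hb, hb'⟩ := hB
  let c : M.Energy := ⟨min b M.emax, Nat.lt_succ_of_le (min_le_right _ _)⟩
  have hc0 : c ≠ 0 := by
    intro h
    have : min b M.emax = 0 := congrArg Fin.val h
    omega
  have hc : M.cappedArrival c ≠ 0 := by
    rw [← PMF.mem_support_iff, Model.cappedArrival, PMF.mem_support_map_iff]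
    exact ⟨b, hb', rfl⟩
  have h1 := sum_toReal_pmf M.cappedArrival
  have h2 : ∑ a ∈ {(0 : M.Energy), c}, (M.cappedArrival a).toReal
      ≤ ∑ a, (M.cappedArrival a).toReal :=
    Finset.sum_le_sum_of_subset_of_nonneg (Finset.subset_univ _)
      fun _ _ _ => ENNReal.toReal_nonneg
  rw [Finset.sum_pair hc0.symm, h1] at h2
  have h3 := toReal_pmf_pos.2 hc
  rw [Model.chargeProb]
  linarith

theorem Model.sub_zero_le_of_bellman_eq (hB : ∃ b, 0 < b ∧ M.arrivalLaw b ≠ 0)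
    (hr0 : ∀ s, r s 0 = 0) {R : ℝ} (hR : ∀ s, ∀ x ≤ M.emax, r s x ≤ R) (hβ : 1 / 2 ≤ β)
    (hβ1 : β < 1) (hV : M.bellman r β V = V) (e : M.Energy) :
    V e - V 0 ≤ e * (2 * R / M.chargeProb) := by
  obtain ⟨n, hn⟩ := e
  induction n with
  | zero => exact le_of_eq (by simp)
  | succ n ih =>
    have ih' := ih (by omega)
    have hq := Model.chargeProb_pos (by omega) hB
    have h1 := Model.sub_le_of_bellman_eq hr0 hR (by linarith) hβ1 hV
      (e := ⟨n, by omega⟩) (e' := ⟨n + 1, hn⟩) rfl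
    have hm : 0 ≤ V ⟨n + 1, hn⟩ - V ⟨n, by omega⟩ := sub_nonneg.2
      (Model.monotone_of_bellman_eq (by linarith) hβ1 hV (by simp))
    -- The factor `2` absorbs `β ≥ 1 / 2`, so the bound does not depend on the discount.
    have h2 : V ⟨n + 1, hn⟩ - V ⟨n, by omega⟩ ≤ 2 * R / M.chargeProb := by
      rw [le_div_iff₀ hq]
      nlinarith [mul_nonneg hq.le hm]
    push_cast at ih' ⊢
    linarith

end Discounted

theorem Model.continuous_bellman (r : M.channels → ℕ → ℝ) :
    Continuous fun p : ℝ × (M.Energy → ℝ) => M.bellman r p.1 p.2 := by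
  refine continuous_pi fun e => continuous_finsetSum _ fun s _ => continuous_const.mul ?_
  refine Continuous.finset_sup'_apply _ fun x _ => ?_
  unfold Model.nextMean
  fun_prop

/-- The average reward optimality equation has a solution. -/
theorem Model.exists_average_optimality_equation (hB : ∃ b, 0 < b ∧ M.arrivalLaw b ≠ 0)
    (hr0 : ∀ s, r s 0 = 0) :
    ∃ (g : ℝ) (h : M.Energy → ℝ), ∀ e, M.bellman r 1 h e = g + h e := by
  obtain ⟨R, hR⟩ : ∃ R, ∀ s, ∀ x ≤ M.emax, r s x ≤ R := by
    refine ⟨∑ s, ∑ x ∈ Finset.range (M.emax + 1), |r s x|, fun s x hx => ?_⟩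
    refine (le_abs_self _).trans ((Finset.single_le_sum (f := fun x => |r s x|)
      (fun _ _ => abs_nonneg _) (Finset.mem_range.2 (Nat.lt_succ_of_le hx))).trans ?_)
    exact Finset.single_le_sum (f := fun s => ∑ x ∈ Finset.range (M.emax + 1), |r s x|)
      (fun _ _ => Finset.sum_nonneg fun _ _ => abs_nonneg _) (Finset.mem_univ s)
  -- The offset `2` makes the discounts start at `1 / 2`, as the uniform bound on increments
  -- requires.
  let β : ℕ → ℝ := fun n => 1 - 1 / ((n : ℝ) + 2)
  have hβ : ∀ n, 1 / 2 ≤ β n ∧ β n < 1 := fun n => by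
    have h1 : (0 : ℝ) < 1 / ((n : ℝ) + 2) := by positivity
    have h2 : 1 / ((n : ℝ) + 2) ≤ 1 / 2 :=
      one_div_le_one_div_of_le (by norm_num) (by linarith [(Nat.cast_nonneg n : (0 : ℝ) ≤ n)])
    constructor <;> simp only [β] <;> linarith
  have hβlim : Tendsto β atTop (𝓝 1) := by
    have h := (tendsto_one_div_add_atTop_nhds_zero_nat (𝕜 := ℝ)).comp (tendsto_add_atTop_nat 1)
    have h' : Tendsto (fun n : ℕ => 1 / ((n : ℝ) + 2)) atTop (𝓝 0) :=
      h.congr fun n => by simp only [Function.comp, Nat.cast_add, Nat.cast_one]; ring_nf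
    simpa [β] using h'.const_sub 1
  choose V hV using fun n => Model.exists_bellman_eq r (M := M) (β := β n)
    (by linarith [(hβ n).1]) (hβ n).2
  -- The values `V n` may blow up as the discount tends to one, but these normalized gains and
  -- relative values stay in a compact box; a limit point is the pair `(g, h)`.
  let u : ℕ → ℝ × (M.Energy → ℝ) := fun n => ((1 - β n) * V n 0, fun e => V n e - V n 0)
  have hu : ∀ n, u n ∈ Set.Icc (0 : ℝ) R ×ˢ Set.Icc (0 : M.Energy → ℝ)
      (fun e => e * (2 * R / M.chargeProb)) := by
    intro n
    have h0 : 0 ≤ β n := by linarith [(hβ n).1]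
    refine ⟨⟨mul_nonneg (by linarith [(hβ n).2])
      (Model.nonneg_of_bellman_eq hr0 h0 (hβ n).2 (hV n) 0),
      Model.one_sub_mul_le_of_bellman_eq hR h0 (hβ n).2 (hV n) 0⟩, fun e => ?_, fun e => ?_⟩
    · exact sub_nonneg.2 (Model.monotone_of_bellman_eq h0 (hβ n).2 (hV n) (Fin.zero_le e))
    · exact Model.sub_zero_le_of_bellman_eq hB hr0 hR (hβ n).1 (hβ n).2 (hV n) e
  obtain ⟨⟨g, h⟩, -, φ, hφ, hlim⟩ := (isCompact_Icc.prod isCompact_Icc).tendsto_subseq hu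
  refine ⟨g, h, fun e => ?_⟩
  have heq : ∀ n, M.bellman r (β n) (u n).2 e = (u n).1 + (u n).2 e := by
    intro n
    simp only [u]
    rw [Model.bellman_sub_const (by linarith [(hβ n).1]), hV]
    ring
  have hl1 := (continuous_fst.tendsto _).comp hlim
  have hl2 := (continuous_snd.tendsto _).comp hlim
  have h1 := (((Model.continuous_bellman r).tendsto (1, h)).comp
    ((hβlim.comp hφ.tendsto_atTop).prodMk_nhds hl2))
  have h1' := tendsto_pi_nhds.1 h1 e
  have h2 := hl1.add (tendsto_pi_nhds.1 hl2 e)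
  refine tendsto_nhds_unique h1' (h2.congr fun n => ?_)
  exact (heq (φ n)).symm

end

/-! ### From the optimality equation to long-term rates, and back to the actions. -/

variable {N : ℕ} {M : Model N}

theorem Model.energyLaw_succ_toReal (μ : M.Policy) (e₀ : M.Energy) (k : ℕ) (y : M.Energy) :
    (M.energyLaw μ e₀ (k + 1) y).toReal
      = ∑ x, (M.energyLaw μ e₀ k x).toReal * (M.step μ x y).toReal := by
  rw [Model.energyLaw, PMF.bind_apply, tsum_fintype,
    ENNReal.toReal_sum fun x _ => ENNReal.mul_ne_top (PMF.apply_ne_top _ _) (PMF.apply_ne_top _ _)]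
  simp only [ENNReal.toReal_mul]

theorem Model.avgRate_eq_liminf (κ : Coding) (μ : M.Policy) (e₀ : M.Energy) :
    M.avgRate κ μ e₀ = liminf (fun K => ∑ e,
      occupation (fun k e => (M.energyLaw μ e₀ k e).toReal) K e * M.slotRate κ μ e) atTop := by
  rw [Model.avgRate]
  congr 1
  funext K
  simp only [occupation, div_mul_eq_mul_div]
  rw [← Finset.sum_div, Finset.sum_comm]
  simp only [Finset.sum_mul]

theorem Model.reflTransGen_toReal_pos (μ : M.Policy) :
    Relation.ReflTransGen (fun a b => 0 < (M.step μ a b).toReal) = M.Reach μ := by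
  unfold Model.Reach
  simp only [toReal_pmf_pos]

theorem Model.reach_of_energyLaw_ne_zero {μ : M.Policy} {e₀ : M.Energy} {k : ℕ} {e : M.Energy}
    (h : M.energyLaw μ e₀ k e ≠ 0) : M.Reach μ e₀ e := by
  induction k generalizing e with
  | zero =>
    rw [Model.energyLaw, ← PMF.mem_support_iff, PMF.mem_support_pure_iff] at h
    exact h ▸ Relation.ReflTransGen.refl
  | succ k ih =>
    rw [Model.energyLaw, ← PMF.mem_support_iff, PMF.mem_support_bind_iff] at h
    obtain ⟨a, ha, hae⟩ := h
    exact (ih ha).tail hae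

theorem Model.sum_step_mul (μ : M.Policy) (h : M.Energy → ℝ) (e : M.Energy) :
    ∑ y, (M.step μ e y).toReal * h y = ∑ s, (M.channelLaw s).toReal *
      ∑' ρ, (μ e s ρ).toReal * M.nextMean h e ρ.total := by
  rw [Model.step, sum_bind_toReal_mul, tsum_fintype]
  simp only [sum_bind_toReal_mul, Model.sum_map_arrivalLaw]

theorem Model.sum_step_toPolicy_mul (μ : M.DetPolicy) (h : M.Energy → ℝ) (e : M.Energy) :
    ∑ y, (M.step μ.toPolicy e y).toReal * h y = ∑ s, (M.channelLaw s).toReal *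
      M.nextMean h e (μ e s).total := by
  rw [Model.sum_step_mul]
  simp only [Model.DetPolicy.toPolicy, tsum_toReal_pure_mul]

theorem Model.slotRate_toPolicy (κ : Coding) (μ : M.DetPolicy) (e : M.Energy) :
    M.slotRate κ μ.toPolicy e = ∑ s : M.channels, (M.channelLaw s).toReal *
      rate κ (μ e s).power s := by
  simp only [Model.slotRate, Model.DetPolicy.toPolicy, tsum_toReal_pure_mul]

theorem Model.gains (s : M.channels) : ∀ r, 0 ≤ s.1.1 r ∧ 0 ≤ s.1.2 r := M.gain_nonneg s.1 s.2

theorem Alloc.mem_splits {e : ℕ} (ρ : Alloc N e) : ρ.power ∈ splits N ρ.total :=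
  ⟨ρ.nonneg, ρ.sum_power⟩

/-- The optimally split secrecy rate, as a function of the number of energy quanta used. -/
def Model.reward (M : Model N) (κ : Coding) (s : M.channels) (x : ℕ) : ℝ := optRate κ s.1 x

theorem Model.reward_zero (hN : 0 < N) (κ : Coding) (s : M.channels) : M.reward κ s 0 = 0 := by
  rw [Model.reward, Nat.cast_zero, optRate_zero hN κ (Model.gains s)]

theorem Model.rate_le_reward (hN : 0 < N) (κ : Coding) (s : M.channels) {e : ℕ} (ρ : Alloc N e) :
    rate κ ρ.power s ≤ M.reward κ s ρ.total :=
  rate_le_optRate hN κ (Model.gains s) ρ.mem_splits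

theorem Model.exists_alloc_eq_reward (hN : 0 < N) (κ : Coding) (s : M.channels) {e x : ℕ}
    (hx : x ≤ e) : ∃ ρ : Alloc N e, ρ.total = x ∧ rate κ ρ.power s = M.reward κ s x := by
  obtain ⟨τ, hτ, -, h⟩ := exists_optimal_split hN κ s.1 (Model.gains s) (Nat.cast_nonneg x)
  exact ⟨⟨τ, x, hτ.1, hτ.2, hx⟩, rfl, h.symm⟩

/-- Value of using `x` energy quanta at level `e` in the channel state `s`. -/
def Model.actionValue (M : Model N) (κ : Coding) (h : M.Energy → ℝ) (e : M.Energy)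
    (s : M.channels) (x : ℕ) : ℝ := M.reward κ s x + M.nextMean h e x

/-- The largest value of an action at level `e` in the channel state `s`. -/
def Model.bestValue (M : Model N) (κ : Coding) (h : M.Energy → ℝ) (e : M.Energy)
    (s : M.channels) : ℝ :=
  (Finset.range (e + 1)).sup' Finset.nonempty_range_add_one (M.actionValue κ h e s)

theorem Model.actionValue_le_bestValue (κ : Coding) (h : M.Energy → ℝ) (e : M.Energy)
    (s : M.channels) {x : ℕ} (hx : x ≤ e) : M.actionValue κ h e s x ≤ M.bestValue κ h e s :=
  Finset.le_sup' (M.actionValue κ h e s) (Finset.mem_range.2 (Nat.lt_succ_of_le hx))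

theorem Model.bellman_reward (κ : Coding) (h : M.Energy → ℝ) (e : M.Energy) :
    M.bellman (M.reward κ) 1 h e = ∑ s, (M.channelLaw s).toReal * M.bestValue κ h e s := by
  simp only [Model.bellman, one_mul, Model.bestValue, Model.actionValue]
  rfl

theorem Model.slotRate_add_le_bellman (hN : 0 < N) (κ : Coding) (ν : M.Policy) (h : M.Energy → ℝ)
    (e : M.Energy) : M.slotRate κ ν e + ∑ y, (M.step ν e y).toReal * h y
      ≤ M.bellman (M.reward κ) 1 h e := by
  rw [Model.sum_step_mul, Model.slotRate, ← Finset.sum_add_distrib, Model.bellman_reward]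
  refine Finset.sum_le_sum fun s _ => ?_
  rw [← mul_add]
  refine mul_le_mul_of_nonneg_left ?_ ENNReal.toReal_nonneg
  have h1 : ∀ ρ : Alloc N e, |rate κ ρ.power s| ≤ rateBound s.1 * e := fun ρ => by
    refine (abs_rate_le κ (Model.gains s) ρ.nonneg).trans ?_
    rw [ρ.sum_power]
    exact mul_le_mul_of_nonneg_left (by exact_mod_cast ρ.total_le)
      (rateBound_nonneg (Model.gains s))
  have h2 : ∀ ρ : Alloc N e, |M.nextMean h e ρ.total| ≤ ∑ y, |h y| := fun ρ => by
    rw [← M.sum_map_arrivalLaw]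
    exact abs_sum_mul_le_of_mem_stdSimplex (toReal_pmf_mem_stdSimplex _) h
  rw [← (summable_toReal_pmf_mul (ν e s) h1).tsum_add (summable_toReal_pmf_mul (ν e s) h2)]
  simp only [← mul_add]
  refine tsum_toReal_pmf_mul_le (ν e s)
    (fun ρ => (abs_add_le _ _).trans (add_le_add (h1 ρ) (h2 ρ))) fun ρ => ?_
  have h3 := M.rate_le_reward hN κ s ρ
  have h4 := Model.actionValue_le_bestValue κ h e s ρ.total_le
  rw [Model.actionValue] at h4
  linarith

/-- A deterministic policy attains the maximum in the optimality equation at level `e` exactly if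
each of its actions does. -/
theorem Model.slotRate_add_eq_bellman_iff (hN : 0 < N) (κ : Coding) (μ : M.DetPolicy)
    (h : M.Energy → ℝ) (e : M.Energy) :
    M.slotRate κ μ.toPolicy e + ∑ y, (M.step μ.toPolicy e y).toReal * h y
      = M.bellman (M.reward κ) 1 h e ↔
    ∀ s : M.channels, rate κ (μ e s).power s = M.reward κ s (μ e s).total ∧
      M.actionValue κ h e s (μ e s).total = M.bestValue κ h e s := by
  rw [Model.sum_step_toPolicy_mul, Model.slotRate_toPolicy, ← Finset.sum_add_distrib,
    Model.bellman_reward]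
  simp only [← mul_add]
  have hle : ∀ s : M.channels, rate κ (μ e s).power s + M.nextMean h e (μ e s).total
      ≤ M.bestValue κ h e s := fun s =>
    (add_le_add_left (M.rate_le_reward hN κ s (μ e s)) _).trans
      (Model.actionValue_le_bestValue κ h e s (μ e s).total_le)
  -- The inequality holds for each channel state, and every channel state has positive weight, so
  -- equality of the means forces equality in each state.
  rw [Finset.sum_eq_sum_iff_of_le fun s _ =>
    mul_le_mul_of_nonneg_left (hle s) ENNReal.toReal_nonneg]
  have hw : ∀ s, (M.channelLaw s).toReal ≠ 0 := fun s =>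
    (toReal_pmf_pos.2 (M.channelLaw_pos s)).ne'
  refine ⟨fun H s => ?_, fun H s _ => ?_⟩
  · have h1 := mul_left_cancel₀ (hw s) (H s (Finset.mem_univ s))
    have h2 := M.rate_le_reward hN κ s (μ e s)
    have h3 := Model.actionValue_le_bestValue κ h e s (μ e s).total_le
    have h4 : M.actionValue κ h e s (μ e s).total
      = M.reward κ s (μ e s).total + M.nextMean h e (μ e s).total := rfl
    constructor <;> linarith
  · rw [(H s).1, ← (H s).2, Model.actionValue]

theorem Model.energyLaw_mem_stdSimplex (μ : M.Policy) (e₀ : M.Energy) (k : ℕ) :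
    (fun e => (M.energyLaw μ e₀ k e).toReal) ∈ stdSimplex ℝ M.Energy :=
  toReal_pmf_mem_stdSimplex _

/-- The solution of the optimality equation bounds the long-term secrecy rate of every policy. -/
theorem Model.avgRate_le (hN : 0 < N) {κ : Coding} {g : ℝ} {h : M.Energy → ℝ}
    (hopt : ∀ e, M.bellman (M.reward κ) 1 h e = g + h e) (ν : M.Policy) (e₀ : M.Energy) :
    M.avgRate κ ν e₀ ≤ g := by
  obtain ⟨π, hπ, -, hle⟩ := exists_isStationary_liminf_le (Model.energyLaw_mem_stdSimplex ν e₀)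
    (Model.energyLaw_succ_toReal ν e₀) (M.slotRate κ ν)
  rw [Model.avgRate_eq_liminf]
  refine hle.trans ?_
  rw [hπ.sum_eq_sub _ h g, sub_le_self_iff]
  refine Finset.sum_nonneg fun e _ => mul_nonneg (hπ.mem.1 e) ?_
  have := M.slotRate_add_le_bellman hN κ ν h e
  rw [hopt] at this
  linarith

/-- Stationary distributions live on `C`, so the evaluation equation is needed only there. This
leaves room for an `f` other than the solution `h`, such as a shift of `h`. -/
theorem Model.le_avgRate_of_closed {κ : Coding} {g : ℝ} {f : M.Energy → ℝ}
    {μ : M.Policy} {C : Set M.Energy} (hC : ∀ x ∈ C, ∀ y, M.step μ x y ≠ 0 → y ∈ C)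
    (hreach : ∀ x, ∃ y ∈ C, M.Reach μ x y)
    (hg : ∀ x ∈ C, M.slotRate κ μ x + ∑ y, (M.step μ x y).toReal * f y = g + f x)
    (e₀ : M.Energy) : g ≤ M.avgRate κ μ e₀ := by
  rw [Model.avgRate_eq_liminf]
  refine le_liminf_of_forall_isStationary (Model.energyLaw_mem_stdSimplex μ e₀)
    (Model.energyLaw_succ_toReal μ e₀) (M.slotRate κ μ) fun π hπ => ?_
  refine (hπ.sum_eq_of_closed (fun x => toReal_pmf_mem_stdSimplex _) (C := C)
    (fun x hx y hy => hC x hx y (toReal_pmf_pos.1 hy)) ?_ hg).ge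
  rwa [Model.reflTransGen_toReal_pos]

/-- A policy whose long-term rate from a recurrent level is the optimal one attains the maximum in
the optimality equation at every level of the recurrent class. -/
theorem Model.slotRate_add_eq_of_recurrent (hN : 0 < N) {κ : Coding} {g : ℝ} {h : M.Energy → ℝ}
    (hopt : ∀ e, M.bellman (M.reward κ) 1 h e = g + h e) {μ : M.Policy} {e₀ : M.Energy}
    (hrec : M.IsRecurrent μ e₀) (hg : g ≤ M.avgRate κ μ e₀) {e : M.Energy}
    (he : M.Reach μ e₀ e) :
    M.slotRate κ μ e + ∑ y, (M.step μ e y).toReal * h y = M.bellman (M.reward κ) 1 h e := by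
  obtain ⟨π, hπ, hsupp, hle⟩ := exists_isStationary_liminf_le
    (Model.energyLaw_mem_stdSimplex μ e₀) (Model.energyLaw_succ_toReal μ e₀) (M.slotRate κ μ)
  rw [← Model.avgRate_eq_liminf, hπ.sum_eq_sub _ h g] at hle
  have hgap : ∀ x, 0 ≤ g + h x - M.slotRate κ μ x - ∑ y, (M.step μ x y).toReal * h y := by
    intro x
    have := M.slotRate_add_le_bellman hN κ μ h x
    rw [hopt] at this
    linarith
  have hnn : ∀ x ∈ Finset.univ, 0 ≤ π x *
      (g + h x - M.slotRate κ μ x - ∑ y, (M.step μ x y).toReal * h y) :=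
    fun x _ => mul_nonneg (hπ.mem.1 x) (hgap x)
  have hsum := (Finset.sum_eq_zero_iff_of_nonneg hnn).1
    (le_antisymm (by linarith) (Finset.sum_nonneg hnn)) e (Finset.mem_univ e)
  -- The gap vanishes wherever `π` has mass. Some charged level is visited from `e₀`, and by
  -- recurrence it leads back to `e₀` and on to `e`, so `e` is charged as well.
  obtain ⟨a, ha⟩ : ∃ a, π a ≠ 0 := by
    by_contra! hz
    have := hπ.mem.2
    simp [hz] at this
  obtain ⟨k, hk⟩ := hsupp a ha
  have hae : M.Reach μ a e :=
    (hrec a (Model.reach_of_energyLaw_ne_zero (k := k) fun h0 => hk (by rw [h0, ENNReal.toReal_zero]))).trans he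
  rw [← Model.reflTransGen_toReal_pos] at hae
  have hpos : 0 < π e := hπ.pos_of_reflTransGen (fun _ _ => ENNReal.toReal_nonneg)
    (lt_of_le_of_ne (hπ.mem.1 a) (Ne.symm ha)) hae
  have := (mul_eq_zero.1 hsum).resolve_left hpos.ne'
  rw [hopt]
  linarith

theorem Model.step_toPolicy_ne_zero_iff {μ : M.DetPolicy} {a b : M.Energy} :
    M.step μ.toPolicy a b ≠ 0 ↔
      ∃ s q, M.arrivalLaw q ≠ 0 ∧ M.update a (μ a s).total q = b := by
  rw [← PMF.mem_support_iff, Model.step, PMF.mem_support_bind_iff]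
  simp only [Model.DetPolicy.toPolicy, PMF.pure_bind, PMF.mem_support_map_iff]
  exact ⟨fun ⟨s, _, q, hq, h⟩ => ⟨s, q, hq, h⟩,
    fun ⟨s, q, hq, h⟩ => ⟨s, M.channelLaw_pos s, q, hq, h⟩⟩

/-! ### Maximizers of the action value and their order in the channel state. -/

/-- Largest maximizers of the action value. -/
theorem Model.exists_largest_maximizer (κ : Coding) (h : M.Energy → ℝ) (e : M.Energy)
    (s : M.channels) : ∃ x ≤ (e : ℕ), M.actionValue κ h e s x = M.bestValue κ h e s ∧
      ∀ y ≤ (e : ℕ), x < y → M.actionValue κ h e s y < M.bestValue κ h e s := by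
  classical
  obtain ⟨x₀, hx₀, h₀⟩ := Finset.exists_mem_eq_sup' (Finset.nonempty_range_add_one (n := (e : ℕ)))
    (M.actionValue κ h e s)
  obtain ⟨x, hx, hmax⟩ := Finset.exists_max_image ((Finset.range (e + 1)).filter fun x =>
    M.actionValue κ h e s x = M.bestValue κ h e s) id
    ⟨x₀, Finset.mem_filter.2 ⟨hx₀, h₀.symm⟩⟩
  rw [Finset.mem_filter, Finset.mem_range, Nat.lt_succ_iff] at hx
  refine ⟨x, hx.1, hx.2, fun y hy hxy => ?_⟩
  refine lt_of_le_of_ne (Model.actionValue_le_bestValue κ h e s hy) fun heq => ?_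
  have := hmax y (Finset.mem_filter.2 ⟨Finset.mem_range.2 (Nat.lt_succ_of_le hy), heq⟩)
  exact absurd hxy (not_lt.2 this)

/-- `x'` and `x''` maximize the action values of `s'` and `s''`, and the difference of the rates
is monotone: if `x'' < x'`, then both maximize both action values. -/
theorem Model.exchange {κ : Coding} {h : M.Energy → ℝ} {e : M.Energy} {s' s'' : M.channels}
    (hm : MonotoneOn (fun y => optRate κ s''.1 y - optRate κ s'.1 y) (Set.Icc 0 (M.emax : ℝ)))
    {x' x'' : ℕ} (hx' : x' ≤ e) (hx'' : x'' ≤ e) (hlt : x'' < x')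
    (h' : M.actionValue κ h e s' x' = M.bestValue κ h e s')
    (h'' : M.actionValue κ h e s'' x'' = M.bestValue κ h e s'') :
    M.actionValue κ h e s' x'' = M.bestValue κ h e s' ∧
      M.actionValue κ h e s'' x' = M.bestValue κ h e s'' ∧
      optRate κ s''.1 x' - optRate κ s'.1 x' ≤ optRate κ s''.1 x'' - optRate κ s'.1 x'' := by
  have he : (e : ℕ) ≤ M.emax := Nat.lt_succ_iff.1 e.2
  have h1 := Model.actionValue_le_bestValue κ h e s' hx''
  have h2 := Model.actionValue_le_bestValue κ h e s'' hx'
  have h3 := hm (a := (x'' : ℝ)) ⟨Nat.cast_nonneg _, by exact_mod_cast hx''.trans he⟩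
    (b := (x' : ℝ)) ⟨Nat.cast_nonneg _, by exact_mod_cast hx'.trans he⟩ (by exact_mod_cast hlt.le)
  -- In the sum of `h1` and `h2` the future terms cancel, leaving the reverse of `h3`; so all three
  -- are equalities.
  simp only [Model.actionValue, Model.reward] at h1 h2 h3 h' h'' ⊢
  refine ⟨?_, ?_, ?_⟩ <;> linarith

theorem Model.exists_detPolicy (hN : 0 < N) (κ : Coding) (x : M.Energy → M.channels → ℕ)
    (hx : ∀ e s, x e s ≤ e) : ∃ μ : M.DetPolicy, ∀ e s, (μ e s).total = x e s ∧
      rate κ (μ e s).power s = M.reward κ s (x e s) := by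
  choose μ hμ using fun (e : M.Energy) (s : M.channels) =>
    M.exists_alloc_eq_reward hN κ s (hx e s)
  exact ⟨μ, hμ⟩

/-- Without overflow of the battery, shifting the present energy level shifts the next one. -/
theorem Model.update_shift {a a' : M.Energy} {d x q : ℕ} (ha : (a' : ℕ) = a + d) (hx : x ≤ a)
    (hle : (M.update a x q : ℕ) + d ≤ M.emax) :
    (M.update a' x q : ℕ) = M.update a x q + d := by
  have := a'.2
  simp only [Model.update] at hle ⊢
  omega

/-! ### Construction of an optimal secrecy policy by shifting a recurrent class. -/

/-- There is an optimal secrecy policy each of whose actions either uses no power in all channel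
states or maximizes the action value at some (shifted) energy level. -/
theorem Model.exists_isOSP (hN : 0 < N) (hB : ∃ b, 0 < b ∧ M.arrivalLaw b ≠ 0) {κ : Coding} {g : ℝ}
    {h : M.Energy → ℝ} (hopt : ∀ e, M.bellman (M.reward κ) 1 h e = g + h e)
    {x : M.Energy → M.channels → ℕ} (hx : ∀ e s, x e s ≤ e)
    (hbest : ∀ e s, M.actionValue κ h e s (x e s) = M.bestValue κ h e s) :
    ∃ μ : M.DetPolicy, M.IsOSP κ μ ∧ (∀ e, g ≤ M.avgRate κ μ.toPolicy e) ∧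
      ∀ e, (∀ s, (μ e s).total = 0) ∨ ∃ a, ∀ s, (μ e s).total = x a s := by
  classical
  obtain ⟨γ, hγ⟩ := Model.exists_detPolicy hN κ x hx
  obtain ⟨c, -, hc⟩ := exists_reflTransGen_recurrent (fun a b => M.step γ.toPolicy a b ≠ 0) 0
  change ∀ z, M.Reach γ.toPolicy c z → M.Reach γ.toPolicy z c at hc
  obtain ⟨m, hm, hmax⟩ := Finset.exists_max_image
    (Finset.univ.filter fun a => M.Reach γ.toPolicy c a) id
    ⟨c, Finset.mem_filter.2 ⟨Finset.mem_univ c, Relation.ReflTransGen.refl⟩⟩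
  simp only [Finset.mem_filter, Finset.mem_univ, true_and, id] at hm hmax
  have hm' : (m : ℕ) ≤ M.emax := Nat.lt_succ_iff.1 m.2
  -- The class of `c` under the maximizing policy `γ` has top level `m`; raising it by `d` puts the
  -- top at the full battery. The lowest `d` quanta are then never used inside `C`.
  let d : ℕ := M.emax - m
  let down : M.Energy → M.Energy := fun e => ⟨e - d, by have := e.2; omega⟩
  let C : Set M.Energy := {e | d ≤ e ∧ M.Reach γ.toPolicy c (down e)}
  obtain ⟨μ, hμ⟩ := Model.exists_detPolicy hN κ (fun e s => if e ∈ C then x (down e) s else 0)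
    fun e s => by
      split_ifs
      · exact (hx _ _).trans (Nat.sub_le _ _)
      · exact Nat.zero_le _
  -- The unshifted successor stays in the class, hence at or below `m`, so adding `d` never
  -- overflows and `down` commutes with the update.
  have hnext : ∀ e ∈ C, ∀ s q, M.arrivalLaw q ≠ 0 →
      M.update e (x (down e) s) q ∈ C ∧
        down (M.update e (x (down e) s) q) = M.update (down e) (x (down e) s) q := by
    intro e he s q hq
    have hr : M.Reach γ.toPolicy c (M.update (down e) (x (down e) s) q) :=
      he.2.tail (Model.step_toPolicy_ne_zero_iff.2 ⟨s, q, hq, by rw [(hγ _ _).1]⟩)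
    have hle := Fin.le_def.1 (hmax _ hr)
    have hsh := Model.update_shift (M := M) (a := down e) (a' := e) (d := d) (q := q)
      (by have := he.1; simp only [down]; omega) (hx (down e) s) (by omega)
    have hd : down (M.update e (x (down e) s) q) = M.update (down e) (x (down e) s) q :=
      Fin.ext (by change (M.update e (x (down e) s) q : ℕ) - d = _; omega)
    exact ⟨⟨by omega, by rwa [hd]⟩, hd⟩
  have hclosed : ∀ e ∈ C, ∀ y, M.step μ.toPolicy e y ≠ 0 → y ∈ C := by
    intro e he y hy
    obtain ⟨s, q, hq, rfl⟩ := Model.step_toPolicy_ne_zero_iff.1 hy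
    rw [(hμ e s).1, if_pos he]
    exact (hnext e he s q hq).1
  have hlast : Fin.last M.emax ∈ C := by
    have : down (Fin.last M.emax) = m := Fin.ext (by simp only [down, Fin.val_last]; omega)
    exact ⟨Nat.sub_le _ _, by rwa [this]⟩
  -- Outside `C` no power is used, so each positive arrival raises the level until `C` is entered,
  -- at the latest at the full battery.
  have hreach : ∀ e, ∃ y ∈ C, M.Reach μ.toPolicy e y := by
    obtain ⟨b, hb, hb'⟩ := hB
    suffices ∀ n (e : M.Energy), M.emax - e = n → ∃ y ∈ C, M.Reach μ.toPolicy e y from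
      fun e => this _ e rfl
    intro n
    induction n using Nat.strong_induction_on with
    | _ n ih =>
      intro e hen
      by_cases he : e ∈ C
      · exact ⟨e, he, Relation.ReflTransGen.refl⟩
      · have hlt : (e : ℕ) < M.emax := by
          refine lt_of_le_of_ne (Nat.lt_succ_iff.1 e.2) fun h => he ?_
          rwa [show e = Fin.last M.emax from Fin.ext h]
        obtain ⟨s, -⟩ := M.channelLaw.support_nonempty
        have hstep : M.step μ.toPolicy e (M.update e 0 b) ≠ 0 :=
          Model.step_toPolicy_ne_zero_iff.2 ⟨s, b, hb', by rw [(hμ e s).1, if_neg he]⟩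
        obtain ⟨y, hy, hey⟩ := ih (M.emax - M.update e 0 b)
          (by simp only [Model.update]; omega) _ rfl
        exact ⟨y, hy, Relation.ReflTransGen.head hstep hey⟩
  have hlift : ∀ a b, M.Reach γ.toPolicy a b → M.Reach γ.toPolicy c a →
      ∀ a' ∈ C, down a' = a → ∃ b' ∈ C, down b' = b ∧ M.Reach μ.toPolicy a' b' := by
    intro a b hab hca a' ha' hda
    induction hab with
    | refl => exact ⟨a', ha', hda, Relation.ReflTransGen.refl⟩
    | tail _ hbc ih =>
      obtain ⟨b', hb', rfl, hab'⟩ := ih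
      obtain ⟨s, q, hq, rfl⟩ := Model.step_toPolicy_ne_zero_iff.1 hbc
      have hn := hnext b' hb' s q hq
      refine ⟨_, hn.1, by rw [hn.2, (hγ _ _).1], hab'.tail ?_⟩
      exact Model.step_toPolicy_ne_zero_iff.2 ⟨s, q, hq, by rw [(hμ b' s).1, if_pos hb']⟩
  have hdown_inj : ∀ a ∈ C, ∀ b ∈ C, down a = down b → a = b := by
    intro a ha b hb hab
    have h1 := congrArg Fin.val hab
    have h2 := ha.1
    have h3 := hb.1
    simp only [down] at h1
    exact Fin.ext (by omega)
  have hirr : ∀ a ∈ C, ∀ b ∈ C, M.Reach μ.toPolicy a b := by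
    intro a ha b hb
    obtain ⟨b', hb', hd, hr⟩ := hlift (down a) (down b) ((hc _ ha.2).trans hb.2) ha.2 a ha rfl
    rwa [← hdown_inj b' hb' b hb hd]
  have hstay : ∀ a ∈ C, ∀ b, M.Reach μ.toPolicy a b → b ∈ C := by
    intro a ha b hab
    induction hab with
    | refl => exact ha
    | tail _ hbc ih => exact hclosed _ ih _ hbc
  have hrecC : ∀ a, M.IsRecurrent μ.toPolicy a → a ∈ C := by
    intro a ha
    obtain ⟨y, hy, hay⟩ := hreach a
    exact hstay y hy a (ha y hay)
  have hval : ∀ e ∈ C, M.slotRate κ μ.toPolicy e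
      + ∑ y, (M.step μ.toPolicy e y).toReal * h (down y) = g + h (down e) := by
    intro e he
    rw [M.sum_step_toPolicy_mul μ (fun y => h (down y)), Model.slotRate_toPolicy,
      ← Finset.sum_add_distrib, ← hopt (down e), Model.bellman_reward]
    refine Finset.sum_congr rfl fun s _ => ?_
    rw [← mul_add, (hμ e s).2, (hμ e s).1, if_pos he, ← hbest, Model.actionValue]
    congr 2
    refine Finset.sum_congr rfl fun b _ => ?_
    -- `hnext` covers only arrivals of positive probability; the others contribute nothing to the
    -- mean.
    by_cases hb : M.cappedArrival b = 0
    · simp [hb]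
    · rw [← ne_eq, ← PMF.mem_support_iff, Model.cappedArrival, PMF.mem_support_map_iff] at hb
      obtain ⟨q, hq, rfl⟩ := hb
      simp only [Model.update_min]
      rw [(hnext e he s q hq).2]
  have hg := Model.le_avgRate_of_closed (f := fun y => h (down y)) hclosed hreach hval
  refine ⟨μ, ⟨fun ν e₀ => (M.avgRate_le hN hopt ν e₀).trans (hg e₀), fun a b ha hb =>
    hirr a (hrecC a ha) b (hrecC b hb), fun e he s => ?_⟩, hg, fun e => ?_⟩
  · have : e ∉ C := fun hmem => he fun y hy => hirr y (hstay e hmem y hy) e hmem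
    rw [(hμ e s).1, if_neg this]
  · by_cases he : e ∈ C
    · exact Or.inr ⟨down e, fun s => by rw [(hμ e s).1, if_pos he]⟩
    · exact Or.inl fun s => by rw [(hμ e s).1, if_neg he]

/-! ### Ties: exchanging single actions of an optimal policy. -/

/-- Replacing an action of an optimal unichain policy at a recurrent level by another maximizer of
the action value, which the policy uses at that level in another channel state. -/
theorem Model.canReplace (hN : 0 < N) {κ : Coding} {g : ℝ} {h : M.Energy → ℝ}
    (hopt : ∀ e, M.bellman (M.reward κ) 1 h e = g + h e) {μ : M.DetPolicy}
    (hg : ∀ e, g ≤ M.avgRate κ μ.toPolicy e) (hμ : M.IsUnichain μ.toPolicy) {e : M.Energy}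
    (he : M.IsRecurrent μ.toPolicy e) {s t : M.channels}
    (hbest : M.actionValue κ h e s (μ e t).total = M.bestValue κ h e s) :
    M.CanReplace κ μ e s (μ e t).total := by
  classical
  obtain ⟨ρ, hρ, hρr⟩ := M.exists_alloc_eq_reward hN κ s (μ e t).total_le
  let ν : M.DetPolicy := Function.update μ e (Function.update (μ e) s ρ)
  have hνe : ν e = Function.update (μ e) s ρ := Function.update_self ..
  have hνa : ∀ a, a ≠ e → ν a = μ a := fun a ha => Function.update_of_ne ha ..
  have hstep : ∀ a, a ≠ e → M.step ν.toPolicy a = M.step μ.toPolicy a := fun a ha => by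
    simp only [Model.step, Model.DetPolicy.toPolicy, hνa a ha]
  -- The new total in state `s` is already used by `μ` at `e` in state `t`, so no new transition
  -- appears.
  have hsub : ∀ a b, M.step ν.toPolicy a b ≠ 0 → M.step μ.toPolicy a b ≠ 0 := by
    intro a b hab
    rcases eq_or_ne a e with rfl | ha
    · obtain ⟨u, q, hq, rfl⟩ := Model.step_toPolicy_ne_zero_iff.1 hab
      rw [Model.step_toPolicy_ne_zero_iff, hνe]
      rcases eq_or_ne u s with rfl | hu
      · exact ⟨t, q, hq, by rw [Function.update_self, hρ]⟩
      · exact ⟨u, q, hq, by rw [Function.update_of_ne hu]⟩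
    · rwa [hstep a ha] at hab
  -- A path of `μ` to the recurrent level `e`, cut at its first visit to `e`, is also a path of `ν`.
  have hto : ∀ a, M.Reach ν.toPolicy a e := by
    intro a
    obtain ⟨c, hac, hc⟩ := exists_reflTransGen_recurrent (fun a b => M.step μ.toPolicy a b ≠ 0) a
    have hae : M.Reach μ.toPolicy a e := hac.trans (hμ c e hc he)
    clear hac
    induction hae using Relation.ReflTransGen.head_induction_on with
    | refl => exact Relation.ReflTransGen.refl
    | head hab hbe ih =>
      rename_i b _
      rcases eq_or_ne b e with rfl | hb
      · exact Relation.ReflTransGen.refl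
      · exact Relation.ReflTransGen.head (by rwa [hstep b hb]) ih
  have hval : ∀ a ∈ {a | M.Reach μ.toPolicy e a},
      M.slotRate κ ν.toPolicy a + ∑ y, (M.step ν.toPolicy a y).toReal * h y = g + h a := by
    intro a ha
    have h1 := (Model.slotRate_add_eq_bellman_iff hN κ μ h a).1
      (Model.slotRate_add_eq_of_recurrent hN hopt he (hg e) ha)
    rw [← hopt, Model.slotRate_add_eq_bellman_iff hN]
    intro u
    rcases eq_or_ne a e with rfl | hae
    · rw [hνe]
      rcases eq_or_ne u s with rfl | hu
      · rw [Function.update_self, hρ]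
        exact ⟨hρr, hbest⟩
      · rw [Function.update_of_ne hu]
        exact h1 u
    · rw [hνa a hae]
      exact h1 u
  have hgν := Model.le_avgRate_of_closed (f := h) (C := {a | M.Reach μ.toPolicy e a})
    (fun a ha b hab => Relation.ReflTransGen.tail ha (hsub a b hab))
    (fun a => ⟨e, Relation.ReflTransGen.refl, hto a⟩) hval
  refine ⟨ν, fun ξ e₀ => (M.avgRate_le hN hopt ξ e₀).trans (hgν e₀),
    fun a b _ hb => (hto a).trans (hb e (hto b)), by rw [hνe, Function.update_self, hρ],
    fun a u hau => ?_⟩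
  rcases eq_or_ne a e with rfl | ha
  · rw [hνe, Function.update_of_ne fun h => hau (by rw [h])]
  · rw [hνa a ha]

/-- At every level an optimal secrecy policy is monotone in the channel state, except for ties. -/
theorem Model.IsOSP.total_le_or_tie (hN : 0 < N) {κ : Coding} {g : ℝ} {h : M.Energy → ℝ}
    (hopt : ∀ e, M.bellman (M.reward κ) 1 h e = g + h e) {μ : M.DetPolicy} (hμ : M.IsOSP κ μ)
    (hg : ∀ e, g ≤ M.avgRate κ μ.toPolicy e) (e : M.Energy) (s' s'' : M.channels)
    (hD : ∀ x ∈ Set.Ioo (0 : ℝ) M.emax, 0 ≤ D κ s'.1 s''.1 x) :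
    (μ e s').total ≤ (μ e s'').total ∨
      ((∀ x ∈ Set.Ioo ((μ e s'').total : ℝ) (μ e s').total, D κ s'.1 s''.1 x = 0) ∧
        M.CanReplace κ μ e s' (μ e s'').total ∧ M.CanReplace κ μ e s'' (μ e s').total) := by
  by_cases he : M.IsRecurrent μ.toPolicy e
  · refine (le_or_gt _ _).imp_right fun hlt => ?_
    have hm := monotoneOn_optRate_sub hN κ (Model.gains s') (Model.gains s'') hD
    have hv := (Model.slotRate_add_eq_bellman_iff hN κ μ h e).1
      (Model.slotRate_add_eq_of_recurrent hN hopt he (hg e) Relation.ReflTransGen.refl)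
    obtain ⟨h1, h2, h3⟩ := Model.exchange hm (μ e s').total_le (μ e s'').total_le hlt
      (hv s').2 (hv s'').2
    refine ⟨fun x hx => D_eq_zero_of_monotoneOn (hm.mono (Set.Icc_subset_Icc
      (Nat.cast_nonneg _) ?_)) h3 hx, Model.canReplace hN hopt hg hμ.unichain he h1,
      Model.canReplace hN hopt hg hμ.unichain he h2⟩
    exact_mod_cast (μ e s').total_le.trans (Nat.lt_succ_iff.1 e.2)
  · left
    rw [hμ.transient e he, hμ.transient e he]

end Secrecy

end

theorem mainTheorem5 {N : ℕ} (hN : 0 < N) (κ : Secrecy.Coding) (M : Secrecy.Model N)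
    (hB : ∃ b, 0 < b ∧ M.arrivalLaw b ≠ 0) :
    -- there is an optimal secrecy policy with the claimed trend (hence the trend holds for the
    -- optimal secrecy policy whenever it is unique)
    (∃ μ : M.DetPolicy, M.IsOSP κ μ ∧
      ∀ (e : M.Energy) (s' s'' : M.channels),
        ((∀ x ∈ Set.Ioo (0 : ℝ) M.emax, 0 ≤ Secrecy.D κ s'.1 s''.1 x) →
          (μ e s').total ≤ (μ e s'').total) ∧
        ((∀ x ∈ Set.Ioo (0 : ℝ) M.emax, Secrecy.D κ s'.1 s''.1 x ≤ 0) →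
          (μ e s'').total ≤ (μ e s').total)) ∧
    -- every optimal secrecy policy has the trend, except for ties
    (∀ μ : M.DetPolicy, M.IsOSP κ μ →
      ∀ (e : M.Energy) (s' s'' : M.channels),
        ((∀ x ∈ Set.Ioo (0 : ℝ) M.emax, 0 ≤ Secrecy.D κ s'.1 s''.1 x) →
          (μ e s').total ≤ (μ e s'').total ∨
            ((∀ x ∈ Set.Ioo ((μ e s'').total : ℝ) (μ e s').total,
                Secrecy.D κ s'.1 s''.1 x = 0) ∧
              M.CanReplace κ μ e s' (μ e s'').total ∧
              M.CanReplace κ μ e s'' (μ e s').total)) ∧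
        ((∀ x ∈ Set.Ioo (0 : ℝ) M.emax, Secrecy.D κ s'.1 s''.1 x ≤ 0) →
          (μ e s'').total ≤ (μ e s').total ∨
            ((∀ x ∈ Set.Ioo ((μ e s').total : ℝ) (μ e s'').total,
                Secrecy.D κ s'.1 s''.1 x = 0) ∧
              M.CanReplace κ μ e s' (μ e s'').total ∧
              M.CanReplace κ μ e s'' (μ e s').total))) := by
  obtain ⟨g, h, hopt⟩ :=
    Secrecy.Model.exists_average_optimality_equation hB (Secrecy.Model.reward_zero hN κ)
  -- Any maximizers would give optimality; the largest ones break all ties consistently, which makes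
  -- the order strict enough for `exchange` to exclude violations.
  choose x hx hbest hlargest using fun e s => M.exists_largest_maximizer κ h e s
  obtain ⟨μ₀, hosp, hg₀, htot⟩ := Secrecy.Model.exists_isOSP hN hB hopt hx hbest
  have hswap : ∀ s' s'' : M.channels,
      (∀ x ∈ Set.Ioo (0 : ℝ) M.emax, Secrecy.D κ s'.1 s''.1 x ≤ 0) →
        ∀ x ∈ Set.Ioo (0 : ℝ) M.emax, 0 ≤ Secrecy.D κ s''.1 s'.1 x := fun s' s'' hD x hx => by
    rw [Secrecy.D_swap]
    exact neg_nonneg.2 (hD x hx)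
  have htrend : ∀ (e : M.Energy) (s' s'' : M.channels),
      (∀ x ∈ Set.Ioo (0 : ℝ) M.emax, 0 ≤ Secrecy.D κ s'.1 s''.1 x) →
        (μ₀ e s').total ≤ (μ₀ e s'').total := by
    intro e s' s'' hD
    obtain h0 | ⟨a, ha⟩ := htot e
    · rw [h0, h0]
    · rw [ha, ha]
      by_contra! hlt
      have := Secrecy.Model.exchange (Secrecy.monotoneOn_optRate_sub hN κ
        (Secrecy.Model.gains s') (Secrecy.Model.gains s'') hD) (hx a s') (hx a s'') hlt
        (hbest a s') (hbest a s'')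
      exact (hlargest a s'' _ (hx a s') hlt).ne this.2.1
  refine ⟨⟨μ₀, hosp, fun e s' s'' => ⟨htrend e s' s'',
    fun hD => htrend e s'' s' (hswap s' s'' hD)⟩⟩, fun μ hμ e s' s'' => ?_⟩
  -- The constructed policy attains `g` from every level, so every optimal policy does too.
  have hg : ∀ e, g ≤ M.avgRate κ μ.toPolicy e := fun e =>
    (hg₀ e).trans (hμ.optimal μ₀.toPolicy e)
  refine ⟨hμ.total_le_or_tie hN hopt hg e s' s'', fun hD => ?_⟩
  refine (hμ.total_le_or_tie hN hopt hg e s'' s' (hswap s' s'' hD)).imp_right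
    fun ⟨h1, h2, h3⟩ => ⟨fun x hx => ?_, h3, h2⟩
  rw [Secrecy.D_swap, h1 x hx, neg_zero]
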